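/- **Setting.** Let $R$ be a closed connected oriented surface of genus $g$ with a finite cell decomposition (given combinatorially by its oriented edges, the counterclockwise cyclic order of the oriented edges leaving each vertex, and the reversal of edges), chosen so that all circles below are embedded circles in the 1-skeleton. A *handlebody diagram* on $R$ is a finite set of disjoint embedded oriented circles whose complement is planar. It is *minimal* if no circle separates two distinct components of the complement (equivalently, it has $g$ circles). It defines a handlebody with boundary $R$, in which the circles bound disks. A *Heegaard diagram* $D$ is a transverse pair of handlebody diagrams, called lower and upper; it is minimal if both of them are. Let $L_l, L_u\subset H_1(R,\mathbb R)$ be the kernels of the maps from $H_1(R,\mathbb R)$ to the first homology of the lower and upper handlebody, and let $\omega$ be the intersection form on $H_1(R,\mathbb R)$. A *sign-ordering* of a finite set is an orbit of the alternating group acting on the set of its complete orderings; an odd permutation takes a sign-ordering to its *reverse*. A *circle slide* replaces one circle $c$ of a handlebody diagram by a circle $c'$ which is a band sum of $c$ with a parallel copy of another circle $k$ of the same handlebody diagram: $c$, $k$ and $c'$ are disjoint and bound a pair of pants in $R$ that is disjoint from the other circles of that handlebody diagram, and $c'$ is oriented parallel to $c$ (the boundary of the pair of pants is $\pm(c'-c)\pm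 k$ as an oriented chain). **Proposition (Casson).** Let $D$ be a minimal Heegaard diagram on $R$ with oriented circles. 1. The form $\omega$ is symplectic, the classes of the lower and upper circles form a basis of the outer direct sum $L_l\oplus L_u$, and the sequence $$0\to L_l\cap L_u\to L_l\oplus L_u\to H_1(R,\mathbb R)\to (L_l\cap L_u)^*\to 0$$ with maps $z\mapsto (z,-z)$, $(x,y)\mapsto x+y$ and $x\mapsto\omega(x,\cdot)$ is exact. 2. Orient $H_1(R,\mathbb R)$ so that $\omega^{\wedge g}>0$, orient $L_l\cap L_u$ in either way, and give $(L_l\cap L_u)^*$ the dual orientation. Through the exact sequence (split into two short exact sequences, where a middle term is oriented by a positive basis of the subspace followed by a lift of a positive basis of the quotient) these induce an orientation of $L_l\oplus L_u$ which does not depend on the chosen orientation of $L_l\cap L_u$. There is a unique sign-ordering of the set of all lower and upper circles that consists of exactly those orderings in which the circles form a positively oriented basis of $L_l\oplus L_u$. Call it the canonical sign-ordering of $D$. 3. The canonical sign-ordering is preserved by circle slides: if $D'$ is a Heegaard diagram obtained from $D$ by a circle slide of a lower circle over a lower circle or of an upper circle over an upper circle, then $D$ and $D'$ have the same canonical sign-ordering,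 the new circle taking the place of the old one. 4. If $D'$ is obtained from $D$ by reversing the orientation of one circle, then the canonical sign-ordering of $D'$ is the reverse of that of $D$. 5. The canonical sign-ordering depends only on $H_1(R,\mathbb R)$, $\omega$ and the classes of the circles: if $D'$ is a Heegaard diagram on a surface $R'$, also with such a cell decomposition, with circles indexed by the same sets, and an isomorphism $H_1(R,\mathbb R)\cong H_1(R',\mathbb R)$ preserves the intersection forms and takes the class of each circle of $D$ to the class of the corresponding circle of $D'$, then the canonical sign-orderings agree. In particular it does not depend on the cell decomposition. -/

import Mathlib

open Module

noncomputable section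

/-! ## Sign-orderings -/

/-- A complete ordering of a finite set `X`, as an enumeration `x₀, x₁, …` of `X`. -/
def CompleteOrdering (X : Type*) [Fintype X] : Type _ := Fin (Fintype.card X) ≃ X

/-- Permutations of `X` act on the complete orderings of `X`. -/
instance CompleteOrdering.instMulAction (X : Type*) [Fintype X] :
    MulAction (Equiv.Perm X) (CompleteOrdering X) where
  smul π e := Equiv.trans e π
  one_smul _ := Equiv.ext fun _ => rfl
  mul_smul _ _ _ := Equiv.ext fun _ => rfl

/-- A sign-ordering of a finite set: an orbit of the alternating group acting on the set of
complete orderings. -/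
def SignOrdering (X : Type*) [Fintype X] [DecidableEq X] : Type _ :=
  MulAction.orbitRel.Quotient (alternatingGroup X) (CompleteOrdering X)

/-- The sign-ordering represented by a complete ordering. -/
def CompleteOrdering.signOrdering {X : Type*} [Fintype X] [DecidableEq X]
    (e : CompleteOrdering X) : SignOrdering X :=
  Quotient.mk (MulAction.orbitRel (alternatingGroup X) (CompleteOrdering X)) e

/-- `t` is the reverse of the sign-ordering `s`: an odd permutation takes `s` to `t`. -/
def SignOrdering.IsReverse {X : Type*} [Fintype X] [DecidableEq X] (s t : SignOrdering X) : Prop :=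
  ∃ (e : CompleteOrdering X) (π : Equiv.Perm X), Equiv.Perm.sign π = -1 ∧
    e.signOrdering = s ∧ (π • e).signOrdering = t

/-! ## Orientations of real vector spaces -/

section Orientations

/-- An orientation of a finite-dimensional real vector space. -/
abbrev VOrientation (V : Type*) [AddCommGroup V] [Module ℝ V] : Type _ :=
  Orientation ℝ V (Fin (finrank ℝ V))

/-- The sign of a finite sequence of vectors relative to an orientation: `1` for a positively
oriented basis, `-1` for a negatively oriented basis, and `0` if the sequence is not a basis. -/
def orientationSign {V : Type*} [AddCommGroup V] [Module ℝ V] (o : VOrientation V)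
    {n : ℕ} (v : Fin n → V) : SignType :=
  if h : finrank ℝ V = n then SignType.sign (o.someVector (v ∘ Fin.cast h)) else 0

/-- `o'` is the orientation of the dual space `V^*` induced by the orientation `o` of `V`: the dual
basis of a basis of `V` has the same sign as that basis. -/
def IsDualOrientation {V : Type*} [AddCommGroup V] [Module ℝ V] (o : VOrientation V)
    (o' : VOrientation (Dual ℝ V)) : Prop :=
  ∀ (n : ℕ) (b : Basis (Fin n) ℝ V), orientationSign o' b.dualBasis = orientationSign o b

/-- The top power `ω ∧ ⋯ ∧ ω` (`g` factors) of a bilinear form, evaluated on `2g` vectors, up to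
a positive factor. Here `finProdFinEquiv (i, 0) = 2i` and `finProdFinEquiv (i, 1) = 2i + 1`. -/
def formPower {V : Type*} [AddCommGroup V] [Module ℝ V] (ω : LinearMap.BilinForm ℝ V)
    (g : ℕ) (v : Fin (g * 2) → V) : ℝ :=
  ∑ π : Equiv.Perm (Fin (g * 2)), ((Equiv.Perm.sign π : ℤ) : ℝ) *
    ∏ i : Fin g, ω (v (π (finProdFinEquiv (i, 0)))) (v (π (finProdFinEquiv (i, 1))))

/-- `o` is the orientation of the `2g`-dimensional space `V` induced by the symplectic form `ω`,
i.e. the one for which the volume form `ω ∧ ⋯ ∧ ω` is positive. -/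
def IsSymplecticOrientation {V : Type*} [AddCommGroup V] [Module ℝ V]
    (ω : LinearMap.BilinForm ℝ V) (o : VOrientation V) : Prop :=
  ∃ g : ℕ, finrank ℝ V = g * 2 ∧
    ∀ v : Fin (g * 2) → V, orientationSign o v = SignType.sign (formPower ω g v)

/-- For an exact sequence `0 → A → B → C → E → 0` with maps `i`, `f`, `p`, the orientation `oB` of
`B` is the one induced by orientations of the other three terms. The convention is the usual one for
the two short exact sequences `0 → A → B → I → 0` and `0 → I → C → E → 0` (`I` the image of `f`):
a basis of the subspace followed by a lift of a basis of the quotient space. -/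
def IsInducedOrientation {A B C E : Type*} [AddCommGroup A] [Module ℝ A] [AddCommGroup B]
    [Module ℝ B] [AddCommGroup C] [Module ℝ C] [AddCommGroup E] [Module ℝ E]
    (i : A →ₗ[ℝ] B) (f : B →ₗ[ℝ] C) (p : C →ₗ[ℝ] E)
    (oA : VOrientation A) (oB : VOrientation B) (oC : VOrientation C) (oE : VOrientation E) : Prop :=
  ∀ (k l m : ℕ) (a : Basis (Fin k) ℝ A) (e : Basis (Fin l) ℝ E) (x : Fin m → B) (y : Fin l → C),
    (∀ j, p (y j) = e j) →
      orientationSign oB (Fin.append (fun j => i (a j)) x) =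
        orientationSign oA a * orientationSign oE e *
          orientationSign oC (Fin.append (fun j => f (x j)) y)

end Orientations

/-! ## Closed oriented surfaces with a cell decomposition -/

/-- A closed connected oriented surface with a finite cell decomposition, presented as a
combinatorial map (rotation system). `Dart` is the set of oriented edges of the 1-skeleton;
`rot d` is the next dart counterclockwise around the initial vertex of `d`, and `rev d` is `d` with
the opposite direction. Vertices, edges and faces are the orbits of `rot`, `rev` and of the
permutation `face` below. -/
structure CellSurface (Dart : Type*) where
  rot : Equiv.Perm Dart
  rev : Equiv.Perm Dart
  rev_rev : ∀ d, rev (rev d) = d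
  rev_ne : ∀ d, rev d ≠ d
  nonempty : Nonempty Dart
  connected : ∀ d e, Relation.EqvGen (fun x y => y = rot x ∨ y = rev x) d e

namespace CellSurface

variable {Dart : Type*} (M : CellSurface Dart)

/-- The next dart along the boundary of the face on the left of `d`: at the final vertex
of `d`, turn to the next edge clockwise. -/
def face : Equiv.Perm Dart := M.rot⁻¹ * M.rev

/-- Two darts start at the same vertex. -/
def SameVertex (d e : Dart) : Prop := M.rot.SameCycle d e

/-- The number of orbits of a permutation of the darts that meet `P`. -/
def orbitsMeeting (π : Equiv.Perm Dart) (P : Set Dart) : ℕ :=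
  ((Quotient.mk (Equiv.Perm.SameCycle.setoid π)) '' P).ncard

/-- Let `P` be a union of faces, i.e. a set of darts that is invariant under `face`. This is
the Euler characteristic of the closed region made of these faces: the number of vertices, minus
the number of edges, plus the number of faces. -/
def eulerChar (P : Set Dart) : ℤ :=
  orbitsMeeting M.rot P - orbitsMeeting M.rev P + orbitsMeeting M.face P

/-! ### First homology -/

section Homology

open Classical in
/-- A real cellular 1-chain is a function `a` on darts with `a (rev d) = - a d`. It is a cycle if
the total flow out of each vertex vanishes. -/
def cycles [Fintype Dart] : Submodule ℝ (Dart → ℝ) where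
  carrier := {a | (∀ d, a (M.rev d) = - a d) ∧ ∀ d, ∑ x with M.SameVertex d x, a x = 0}
  zero_mem' := by simp
  add_mem' := by
    rintro a b ⟨ha, ha'⟩ ⟨hb, hb'⟩
    refine ⟨fun d => by simp [ha, hb]; ring, fun d => ?_⟩
    simp only [Pi.add_apply, Finset.sum_add_distrib, ha', hb', add_zero]
  smul_mem' := by
    rintro r a ⟨ha, ha'⟩
    refine ⟨fun d => by simp [ha], fun d => ?_⟩
    simp only [Pi.smul_apply, ← Finset.smul_sum, ha', smul_zero]

/-- The boundary of a real cellular 2-chain. A 2-chain assigns a number to each face; as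
a function `F` on darts, `F d` is the number of the face on the left of `d`. -/
def bdry : (Dart → ℝ) →ₗ[ℝ] (Dart → ℝ) where
  toFun F d := F d - F (M.rev d)
  map_add' F G := by ext d; simp; ring
  map_smul' r F := by ext d; simp; ring

/-- The space of 2-chains: functions on darts that are constant on each face. -/
def twoChains : Submodule ℝ (Dart → ℝ) where
  carrier := {F | ∀ d, F (M.face d) = F d}
  zero_mem' := by simp
  add_mem' := by
    intro F G hF hG d
    simp [hF d, hG d]
  smul_mem' := by
    intro r F hF d
    simp [hF d]

/-- The boundaries of 2-chains. -/
def boundaries : Submodule ℝ (Dart → ℝ) := M.twoChains.map M.bdry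

variable [Fintype Dart]

/-- The first homology `H₁(R, ℝ)`: cycles modulo boundaries. -/
abbrev H1 : Type _ := M.cycles ⧸ M.boundaries.submoduleOf M.cycles

/-- For a cycle `b`, a function on the corners of the cells that increases by `b d`
when `d` is crossed counterclockwise around its initial vertex (the corner attached to `d` is the
one just before `d`), normalized explicitly at each vertex. -/
def potential : (Dart → ℝ) →ₗ[ℝ] (Dart → ℝ) where
  toFun b d := (∑ m ∈ Finset.range (Function.minimalPeriod M.rot d), (m : ℝ) * b ((M.rot ^ m) d)) /
    Function.minimalPeriod M.rot d
  map_add' a b := by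
    ext d; simp [mul_add, Finset.sum_add_distrib, add_div]
  map_smul' r a := by
    ext d; simp [mul_left_comm, ← Finset.mul_sum, mul_div_assoc]

/-- The intersection number of two cycles in the 1-skeleton. Each vertex contributes; two paths that
cross transversely at a vertex contribute `1` if the first followed by the second is a positive frame
and `-1` otherwise, paths that touch without crossing contribute `0`, and where
they meet in a common stretch each end of it contributes a half of the sign. -/
def chainPairing : (Dart → ℝ) →ₗ[ℝ] (Dart → ℝ) →ₗ[ℝ] ℝ :=
  LinearMap.mk₂ ℝ
    (fun a b => - ∑ d, a d * ((M.potential b d + M.potential b (M.rot d)) / 2))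
    (by intro a a' b; simp [add_mul, Finset.sum_add_distrib]; ring)
    (by intro r a b; simp [mul_assoc, Finset.mul_sum])
    (by
      intro a b b'
      simp only [map_add, Pi.add_apply]
      rw [← neg_add, ← Finset.sum_add_distrib]
      congr 1
      exact Finset.sum_congr rfl fun d _ => by ring)
    (by
      intro r a b
      simp only [map_smul, Pi.smul_apply, smul_eq_mul, mul_neg, Finset.mul_sum]
      congr 1
      exact Finset.sum_congr rfl fun d _ => by ring)

open Classical in
theorem sum_sameVertex (b : Dart → ℝ) (d : Dart) :
    ∑ x with M.SameVertex d x, b x =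
      ∑ m ∈ Finset.range (Function.minimalPeriod M.rot d), b ((M.rot ^ m) d) := by
  symm
  have hper : d ∈ Function.periodicPts M.rot := by
    refine ⟨orderOf M.rot, orderOf_pos _, ?_⟩
    rw [Function.IsPeriodicPt, Function.IsFixedPt, ← Equiv.Perm.coe_pow, pow_orderOf_eq_one]
    rfl
  refine Finset.sum_nbij (fun m => (M.rot ^ m) d) ?_ ?_ ?_ (fun _ _ => rfl)
  · intro m _
    simp only [Finset.mem_filter, Finset.mem_univ, true_and]
    exact ⟨m, by simp⟩
  · intro m hm n hn h
    simp only [Equiv.Perm.coe_pow] at h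
    simp only [Finset.coe_range, Set.mem_Iio] at hm hn
    exact Function.iterate_injOn_Iio_minimalPeriod hm hn h
  · intro x hx
    simp only [Finset.coe_filter, Finset.mem_univ, true_and, Set.mem_ofPred_eq] at hx
    obtain ⟨n, rfl⟩ := hx.exists_nat_pow_eq
    refine ⟨n % Function.minimalPeriod M.rot d, ?_, ?_⟩
    · simp only [Finset.coe_range, Set.mem_Iio]
      exact Nat.mod_lt _ (Function.minimalPeriod_pos_of_mem_periodicPts hper)
    · simp only [Equiv.Perm.coe_pow]
      exact Function.iterate_mod_minimalPeriod_eq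

theorem potential_rot {b : Dart → ℝ} (hb : b ∈ M.cycles) (d : Dart) :
    M.potential b (M.rot d) = M.potential b d + b d := by
  have hper : d ∈ Function.periodicPts M.rot := by
    refine ⟨orderOf M.rot, orderOf_pos _, ?_⟩
    rw [Function.IsPeriodicPt, Function.IsFixedPt, ← Equiv.Perm.coe_pow, pow_orderOf_eq_one]
    rfl
  have hpos := Function.minimalPeriod_pos_of_mem_periodicPts hper
  have hsum := hb.2 d
  rw [sum_sameVertex] at hsum
  simp only [potential, LinearMap.coe_mk, AddHom.coe_mk, Function.minimalPeriod_apply hper]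
  have hk : (M.rot ^ Function.minimalPeriod M.rot d) d = d := by
    rw [Equiv.Perm.coe_pow]; exact Function.iterate_minimalPeriod
  generalize Function.minimalPeriod M.rot d = k at *
  have hk0 : (k : ℝ) ≠ 0 := by exact_mod_cast hpos.ne'
  have h1 : ∀ m : ℕ, (M.rot ^ m) (M.rot d) = (M.rot ^ (m + 1)) d := fun m => by
    rw [pow_succ, Equiv.Perm.mul_apply]
  have h2 : ∑ m ∈ Finset.range k, (m : ℝ) * b ((M.rot ^ m) (M.rot d)) =
      ∑ m ∈ Finset.range k, (m : ℝ) * b ((M.rot ^ m) d) + k * b d := by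
    have e := Finset.sum_range_succ (fun m : ℕ => ((m : ℝ) - 1) * b ((M.rot ^ m) d)) k
    rw [Finset.sum_range_succ'] at e
    have e2 : ∑ m ∈ Finset.range k, ((m : ℝ) - 1) * b ((M.rot ^ m) d) =
        ∑ m ∈ Finset.range k, (m : ℝ) * b ((M.rot ^ m) d) := by
      simp only [sub_mul, one_mul, Finset.sum_sub_distrib, hsum, sub_zero]
    rw [e2, hk] at e
    simp only [h1]
    simp only [Nat.cast_add, Nat.cast_one, add_sub_cancel_right, Nat.cast_zero, pow_zero,
      Equiv.Perm.one_apply] at e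
    linarith
  rw [h2, add_div, mul_div_cancel_left₀ _ hk0]

theorem chainPairing_neg {a b : Dart → ℝ} (ha : a ∈ M.cycles) (hb : b ∈ M.cycles) :
    M.chainPairing a b = - M.chainPairing b a := by
  have key : ∑ d, (M.potential a (M.rot d) * M.potential b (M.rot d)) =
      ∑ d, M.potential a d * M.potential b d :=
    Equiv.sum_comp M.rot fun d => M.potential a d * M.potential b d
  simp only [chainPairing, LinearMap.mk₂_apply, neg_neg]
  rw [neg_eq_iff_add_eq_zero, ← Finset.sum_add_distrib, ← sub_eq_zero.mpr key,
    ← Finset.sum_sub_distrib]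
  refine Finset.sum_congr rfl fun d _ => ?_
  rw [M.potential_rot ha, M.potential_rot hb]
  ring

theorem chainPairing_bdry {F b : Dart → ℝ} (hF : F ∈ M.twoChains) (hb : b ∈ M.cycles) :
    M.chainPairing (M.bdry F) b = 0 := by
  set G : Dart → ℝ := fun d => (M.potential b d + M.potential b (M.rot d)) / 2 with hG
  have hrev : ∑ d, F (M.rev d) * G d = ∑ d, F d * G (M.rev d) := by
    rw [← Equiv.sum_comp M.rev]
    exact Finset.sum_congr rfl fun d _ => by rw [M.rev_rev]
  have hface : ∑ d, F d * (M.potential b (M.face d) + b (M.face d)) =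
      ∑ d, F d * (M.potential b d + b d) := by
    rw [← Equiv.sum_comp M.face fun d => F d * (M.potential b d + b d)]
    exact Finset.sum_congr rfl fun d _ => by rw [hF d]
  have hstep : ∀ d, G d - G (M.rev d) =
      (M.potential b d + b d) - (M.potential b (M.face d) + b (M.face d)) := fun d => by
    have h1 : M.rot (M.face d) = M.rev d := by simp [face]
    have h2 := M.potential_rot hb (M.face d)
    rw [h1] at h2
    simp only [hG, M.potential_rot hb, hb.1 d]
    linarith
  have : M.chainPairing (M.bdry F) b = -(∑ d, F d * G d - ∑ d, F (M.rev d) * G d) := by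
    simp only [chainPairing, bdry, LinearMap.mk₂_apply, LinearMap.coe_mk, AddHom.coe_mk,
      ← Finset.sum_sub_distrib, hG, sub_mul]
  rw [this, hrev, ← Finset.sum_sub_distrib]
  simp only [← mul_sub, hstep]
  simp only [mul_sub, Finset.sum_sub_distrib, hface, sub_self, neg_zero]

/-- The intersection form on `H₁(R, ℝ)`, with `⟨[a], [b]⟩ = chainPairing a b`. -/
def intersectionForm : LinearMap.BilinForm ℝ M.H1 :=
  ((M.boundaries.submoduleOf M.cycles).liftQ
    ((M.boundaries.submoduleOf M.cycles).liftQ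
      (M.chainPairing.domRestrict₁₂ M.cycles M.cycles) (by
        rintro ⟨a, ha⟩ h
        obtain ⟨F, hF, rfl⟩ := h
        ext ⟨b, hb⟩
        exact M.chainPairing_bdry hF hb)).flip (by
      rintro ⟨b, hb⟩ h
      obtain ⟨F, hF, rfl⟩ := h
      refine LinearMap.ext fun x => ?_
      obtain ⟨⟨a, ha⟩, rfl⟩ := Submodule.mkQ_surjective _ x
      have h1 := M.chainPairing_neg ha hb
      rw [M.chainPairing_bdry hF ha, neg_zero] at h1
      exact h1)).flip

end Homology

/-! ### Oriented circles -/

/-- An oriented embedded circle in the 1-skeleton: a closed edge path `dart 0, dart 1, …` that visits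
no vertex twice (and, if it has length two, does not run back along the same edge). -/
structure OrientedCircle where
  length : ℕ
  length_ne : NeZero length
  dart : ZMod length → Dart
  next : ∀ i, M.SameVertex (M.rev (dart i)) (dart (i + 1))
  embedded : ∀ i j, M.SameVertex (dart i) (dart j) → i = j
  no_backtrack : ∀ i j, dart i ≠ M.rev (dart j)

attribute [instance] OrientedCircle.length_ne

namespace OrientedCircle

variable {M}

/-- The same circle with the opposite orientation. -/
def reverse (c : M.OrientedCircle) : M.OrientedCircle where
  length := c.length
  length_ne := c.length_ne
  dart i := M.rev (c.dart (-i))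
  next i := by
    rw [M.rev_rev]
    have h := c.next (-(i + 1))
    rw [neg_add, neg_add_cancel_right] at h
    rw [neg_add]
    exact h.symm
  embedded i j h := by
    have h1 := c.next (-i)
    have h2 := c.next (-j)
    have h3 := c.embedded _ _ ((h1.symm.trans h).trans h2)
    exact neg_injective (add_right_cancel h3)
  no_backtrack i j h := by
    rw [M.rev_rev] at h
    exact c.no_backtrack _ _ h.symm

/-- The dart `d` or its reverse belongs to the circle. -/
def OnEdge (c : M.OrientedCircle) (d : Dart) : Prop :=
  ∃ i, c.dart i = d ∨ M.rev (c.dart i) = d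

/-- Two circles have no point in common. -/
def Disjoint (c c' : M.OrientedCircle) : Prop :=
  ∀ i j, ¬ M.SameVertex (c.dart i) (c'.dart j)

/-- The cellular chain of an oriented circle. -/
def chain [DecidableEq Dart] (c : M.OrientedCircle) : Dart → ℝ :=
  ∑ i, (Pi.single (c.dart i) 1 - Pi.single (M.rev (c.dart i)) 1)

theorem chain_mem_cycles [Fintype Dart] [DecidableEq Dart] (c : M.OrientedCircle) :
    c.chain ∈ M.cycles := by
  have hrev : ∀ x y, M.rev x = y ↔ x = M.rev y := fun x y =>
    ⟨fun h => by rw [← h, M.rev_rev], fun h => by rw [h, M.rev_rev]⟩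
  refine ⟨fun d => ?_, fun d => ?_⟩
  · simp only [chain, Finset.sum_apply, Pi.sub_apply, Pi.single_apply, ← Finset.sum_neg_distrib]
    refine Finset.sum_congr rfl fun i _ => ?_
    simp only [hrev d, M.rev_rev]
    ring
  · classical
    simp only [chain, Finset.sum_apply, Pi.sub_apply]
    rw [Finset.sum_comm]
    simp only [Finset.sum_sub_distrib, Finset.sum_pi_single', Finset.mem_filter, Finset.mem_univ,
      true_and]
    rw [sub_eq_zero, ← Equiv.sum_comp (Equiv.addRight (1 : ZMod c.length))]
    refine Finset.sum_congr rfl fun i _ => ?_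
    have : M.SameVertex d (c.dart (i + 1)) ↔ M.SameVertex d (M.rev (c.dart i)) :=
      ⟨fun h => h.trans (c.next i).symm, fun h => h.trans (c.next i)⟩
    simp only [Equiv.coe_addRight, this]

/-- The homology class of an oriented circle. -/
def homologyClass [Fintype Dart] [DecidableEq Dart] (c : M.OrientedCircle) : M.H1 :=
  Submodule.Quotient.mk ⟨c.chain, c.chain_mem_cycles⟩

end OrientedCircle

/-- Going counterclockwise around the common initial vertex of `d`, `x` and `e`, one
meets first `d`, then `x`, then `e`, all distinct. -/
def Between (d x e : Dart) : Prop :=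
  ∃ m n : ℕ, 0 < m ∧ m < n ∧ n < Function.minimalPeriod M.rot d ∧
    (M.rot ^ m) d = x ∧ (M.rot ^ n) d = e

/-- Two circles are transverse: wherever they meet, the four ends of the two circles at that
vertex are distinct and those of one circle separate those of the other. -/
def OrientedCircle.Transverse {M : CellSurface Dart} (c c' : M.OrientedCircle) : Prop :=
  ∀ i j, M.SameVertex (c.dart i) (c'.dart j) →
    (M.Between (c.dart i) (c'.dart j) (M.rev (c.dart (i - 1))) ∧
      M.Between (M.rev (c.dart (i - 1))) (M.rev (c'.dart (j - 1))) (c.dart i)) ∨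
    (M.Between (c.dart i) (M.rev (c'.dart (j - 1))) (M.rev (c.dart (i - 1))) ∧
      M.Between (M.rev (c.dart (i - 1))) (c'.dart j) (c.dart i))

/-! ### Handlebody diagrams and Heegaard diagrams -/

section Diagrams

/-- The faces on the left of two darts lie in the same component of the complement of a family
of circles: one can pass from one to the other across edges that are not on any circle. -/
def componentSetoid {ι : Type*} (circle : ι → M.OrientedCircle) : Setoid Dart :=
  Relation.EqvGen.setoid fun d e =>
    e = M.face d ∨ (e = M.rev d ∧ ∀ i, ¬ (circle i).OnEdge d)

/-- A handlebody diagram: a finite family of disjoint oriented embedded circles whose complement is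
planar. Cutting the surface along `m` disjoint circles and capping off the `2m` boundary circles
gives a closed surface of Euler characteristic `χ + 2m`; if it has `n` components, the genera of these
components add up to `(2n - χ - 2m)/2`, and all components are planar if and only
if this number is zero. -/
structure HandlebodyDiagram (ι : Type*) [Fintype ι] where
  circle : ι → M.OrientedCircle
  disjoint : ∀ i j, i ≠ j → (circle i).Disjoint (circle j)
  planar : M.eulerChar Set.univ + 2 * Fintype.card ι =
    2 * Nat.card (Quotient (M.componentSetoid circle))

/-- A Heegaard diagram with oriented circles: a transverse pair consisting of a lower and an upper
handlebody diagram. -/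
structure HeegaardDiagram (ι κ : Type*) [Fintype ι] [Fintype κ] where
  lower : M.HandlebodyDiagram ι
  upper : M.HandlebodyDiagram κ
  transverse : ∀ i j, (lower.circle i).Transverse (upper.circle j)

variable {M} {ι κ : Type*} [Fintype ι] [Fintype κ]

namespace HandlebodyDiagram

/-- A handlebody diagram is minimal if none of its circles is redundant, i.e. no circle separates two
distinct components of the complement of the diagram. -/
def IsMinimal (H : M.HandlebodyDiagram ι) : Prop :=
  ∀ i j, (M.componentSetoid H.circle).r ((H.circle i).dart j) (M.rev ((H.circle i).dart j))

/-- The boundary chain of the region formed by a union `P` of faces. -/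
def _root_.CellSurface.regionBoundary (M : CellSurface Dart) (P : Set Dart) : Dart → ℝ :=
  M.bdry (P.indicator 1)

/-- `P` is a pair of pants with oriented boundary `η c₁ + ε c₂ + θ c₃` (with signs
`η`, `ε`, `θ`): a connected region with Euler characteristic `-1` whose boundary
consists of these three disjoint circles. -/
structure _root_.CellSurface.IsPairOfPants [DecidableEq Dart] (M : CellSurface Dart)
    (P : Set Dart) (c₁ c₂ c₃ : M.OrientedCircle) (η ε θ : ℤˣ) : Prop where
  union_of_faces : ∀ d, d ∈ P ↔ M.face d ∈ P
  connected : ∀ d ∈ P, ∀ e ∈ P, Relation.EqvGen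
    (fun x y => y = M.face x ∨ (y = M.rev x ∧ x ∈ P ∧ y ∈ P)) d e
  disjoint₁₂ : c₁.Disjoint c₂
  disjoint₁₃ : c₁.Disjoint c₃
  disjoint₂₃ : c₂.Disjoint c₃
  eulerChar : M.eulerChar P = -1
  boundary : M.regionBoundary P =
    ((η : ℤ) : ℝ) • c₁.chain + ((ε : ℤ) : ℝ) • c₂.chain + ((θ : ℤ) : ℝ) • c₃.chain

/-- `H'` is obtained from `H` by a circle slide: one circle `c` slides over another one `k`
of the same handlebody diagram, i.e. it is replaced by a circle `c'` which is the band sum of `c`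
and a parallel copy of `k`. So `c`, `c'` and `k` bound a pair of pants disjoint from all other
circles of the diagram, and `c'` is oriented in parallel to `c`. The orientation of `k`
is arbitrary. -/
def IsSlide [DecidableEq Dart] (H H' : M.HandlebodyDiagram ι) : Prop :=
  ∃ i k, i ≠ k ∧ (∀ j, j ≠ i → H'.circle j = H.circle j) ∧
    ∃ (P : Set Dart) (η ε : ℤˣ),
      M.IsPairOfPants P (H'.circle i) (H.circle i) (H.circle k) η (-η) ε ∧
      ∀ j, j ≠ i → j ≠ k → ∀ s, (H.circle j).dart s ∉ P

/-- `H'` is obtained from `H` by reversing the orientation of one circle. -/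
def IsReversal (H H' : M.HandlebodyDiagram ι) : Prop :=
  ∃ i, H'.circle i = (H.circle i).reverse ∧ ∀ j, j ≠ i → H'.circle j = H.circle j

variable [Fintype Dart] [DecidableEq Dart]

/-- The boundaries in the handlebody: it is obtained from the surface by attaching disks along the
circles (and then balls, which do not change the first homology). -/
def handlebodyBoundaries (H : M.HandlebodyDiagram ι) : Submodule ℝ (Dart → ℝ) :=
  M.boundaries ⊔ Submodule.span ℝ (Set.range fun i => (H.circle i).chain)

/-- The first homology of the handlebody. -/
abbrev handlebodyH1 (H : M.HandlebodyDiagram ι) : Type _ :=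
  M.cycles ⧸ H.handlebodyBoundaries.submoduleOf M.cycles

/-- The map `H₁(R, ℝ) → H₁(B, ℝ)` induced by the inclusion of the surface in the handlebody. -/
def toHandlebody (H : M.HandlebodyDiagram ι) : M.H1 →ₗ[ℝ] H.handlebodyH1 :=
  Submodule.factor (Submodule.comap_mono le_sup_left)

/-- The subspace of `H₁(R, ℝ)` defined by the handlebody: the classes that vanish in it. -/
def lagrangian (H : M.HandlebodyDiagram ι) : Submodule ℝ M.H1 := LinearMap.ker H.toHandlebody

theorem homologyClass_mem_lagrangian (H : M.HandlebodyDiagram ι) (i : ι) :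
    (H.circle i).homologyClass ∈ H.lagrangian := by
  rw [lagrangian, LinearMap.mem_ker]
  refine (Submodule.Quotient.mk_eq_zero _).mpr ?_
  exact Submodule.mem_sup_right (Submodule.subset_span ⟨i, rfl⟩)

/-- The class of a circle as an element of the subspace defined by the handlebody. -/
def circleClass (H : M.HandlebodyDiagram ι) (i : ι) : H.lagrangian :=
  ⟨(H.circle i).homologyClass, H.homologyClass_mem_lagrangian i⟩

end HandlebodyDiagram

namespace HeegaardDiagram

/-- Both handlebody diagrams are minimal. -/
def IsMinimal (D : M.HeegaardDiagram ι κ) : Prop := D.lower.IsMinimal ∧ D.upper.IsMinimal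

/-- A circle slide of a lower circle over a lower circle or of an upper circle over an upper circle. -/
def IsCircleSlide [DecidableEq Dart] (D D' : M.HeegaardDiagram ι κ) : Prop :=
  (D.lower.IsSlide D'.lower ∧ D'.upper = D.upper) ∨ (D'.lower = D.lower ∧ D.upper.IsSlide D'.upper)

/-- Reversal of the orientation of one lower or upper circle. -/
def IsReversal (D D' : M.HeegaardDiagram ι κ) : Prop :=
  (D.lower.IsReversal D'.lower ∧ D'.upper = D.upper) ∨
    (D'.lower = D.lower ∧ D.upper.IsReversal D'.upper)

variable [Fintype Dart] [DecidableEq Dart] (D : M.HeegaardDiagram ι κ)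

/-- The subspace `L_l ∩ L_u` of `H₁(R, ℝ)`. -/
abbrev inter : Submodule ℝ M.H1 := D.lower.lagrangian ⊓ D.upper.lagrangian

/-- The outer direct sum `L_l ⊕ L_u`. -/
abbrev directSum : Type _ := D.lower.lagrangian × D.upper.lagrangian

/-- The map `L_l ∩ L_u → L_l ⊕ L_u`, `z ↦ (z, -z)`. -/
def interToSum : D.inter →ₗ[ℝ] D.directSum :=
  (Submodule.inclusion inf_le_left).prod (-Submodule.inclusion inf_le_right)

/-- The map `L_l ⊕ L_u → H₁(R, ℝ)`, `(x, y) ↦ x + y`. -/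
def sumToH1 : D.directSum →ₗ[ℝ] M.H1 :=
  D.lower.lagrangian.subtype.coprod D.upper.lagrangian.subtype

/-- The map `H₁(R, ℝ) → (L_l ∩ L_u)^*` given by the intersection form, `x ↦ ⟨x, ·⟩`. -/
def h1ToDual : M.H1 →ₗ[ℝ] Dual ℝ D.inter :=
  D.inter.subtype.dualMap ∘ₗ M.intersectionForm

/-- The vectors of `L_l ⊕ L_u` given by the lower and upper circles. -/
def circleVector : ι ⊕ κ → D.directSum :=
  Sum.elim (fun i => (D.lower.circleClass i, 0)) (fun j => (0, D.upper.circleClass j))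

/-- The orientation of `L_l ⊕ L_u` induced through the exact sequence
`0 → L_l ∩ L_u → L_l ⊕ L_u → H₁(R, ℝ) → (L_l ∩ L_u)^* → 0` by the symplectic orientation of
`H₁(R, ℝ)` and by either orientation of `L_l ∩ L_u` together with the dual orientation
of `(L_l ∩ L_u)^*`. -/
def IsCassonOrientation (o : VOrientation D.directSum) : Prop :=
  ∀ oA : VOrientation D.inter, ∃ (oE : VOrientation (Dual ℝ D.inter)) (oH : VOrientation M.H1),
    IsDualOrientation oA oE ∧ IsSymplecticOrientation M.intersectionForm oH ∧
      IsInducedOrientation D.interToSum D.sumToH1 D.h1ToDual oA o oH oE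

/-- `s` is the canonical sign-ordering of the circles of the diagram: it consists of
the orderings in which the circles form a positive basis of `L_l ⊕ L_u`. -/
def IsCanonicalSignOrdering [DecidableEq ι] [DecidableEq κ] (s : SignOrdering (ι ⊕ κ)) : Prop :=
  ∃ o : VOrientation D.directSum, D.IsCassonOrientation o ∧
    ∀ e : CompleteOrdering (ι ⊕ κ),
      e.signOrdering = s ↔ orientationSign o (fun n => D.circleVector (Equiv.toFun e n)) = 1

end HeegaardDiagram

end Diagrams

end CellSurface

end

/-!
Poincaré duality is proved directly on the combinatorial map. A functional on 1-chains that vanishes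
on all cycles comes from the coboundary of a function `u` on the vertices. So if a cycle `b` pairs
to zero with all cycles, its potential minus `u` takes equal values at `rot d` and `rev d`; its value
at `rot d` is then constant on faces and defines a 2-chain with boundary `b`
(`mem_boundaries_of_chainPairing_eq_zero`). Hence the intersection form is nondegenerate.
Counting dimensions of chains gives `finrank H₁ ≤ 2 - χ` (`finrank_H1_le`).

The complement of a minimal handlebody diagram is connected, so planarity says that it has
`g = 1 - χ / 2` circles, and a 2-chain whose boundary is a combination of the circles is constant.
So the classes of the circles are independent and span an isotropic space of dimension `g`. As an
isotropic space has at most half of the dimension of `H₁`, the dimension of `H₁` is `2g` and the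
space is Lagrangian. Exactness of the sequence at `H₁` is the identity
`(L_l ∩ L_u)^⊥ = L_l + L_u`.

The remaining part is linear algebra. Signs of bases change by signs of determinants
(`orientationSign_eq_mul_sign_det`), and block triangular determinants show that an exact sequence
`0 → A → B → C → E → 0` induces an orientation of `B` (`exists_isInducedOrientation`). The top
power of `ω` is an alternating form that is positive on a symplectic basis
(`formPower_pos_of_symplectic`), and a Lagrangian subspace provides such a basis. When the
orientation of `A = L_l ∩ L_u` is changed, that of `E = A^*` changes too, and the induced
orientation stays the same. The whole construction is compatible with isomorphisms
(`IsSymplecticallyInduced.exists_comp`), so it depends only on `ω` and on the classes of the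
circles in `H₁`.
A circle slide replaces the class of `c` by `[c] ± [k]`, which changes neither the Lagrangian
subspaces nor the sign of the basis, and a reversal changes one sign.
-/

/-! ### Signs of sequences of vectors relative to an orientation -/

section OrientationSign

variable {V : Type*} [AddCommGroup V] [Module ℝ V]

theorem orientationSign_of_finrank_ne (o : VOrientation V) {n : ℕ} (h : finrank ℝ V ≠ n)
    (v : Fin n → V) : orientationSign o v = 0 := by
  rw [orientationSign, dif_neg h]

/-- On sequences of the right length, `orientationSign o` is the sign of an alternating form. Most
facts about `orientationSign` are read off from this one. -/
theorem exists_alternatingMap_orientationSign (o : VOrientation V) {n : ℕ} (h : finrank ℝ V = n) :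
    ∃ f : V [⋀^Fin n]→ₗ[ℝ] ℝ, f ≠ 0 ∧ ∀ v, orientationSign o v = SignType.sign (f v) := by
  subst h
  refine ⟨o.someVector, o.someVector_ne_zero, fun v => ?_⟩
  rw [orientationSign, dif_pos rfl]
  rfl

theorem orientationSign_eq_mul_sign_det (o : VOrientation V) {n : ℕ} (b : Basis (Fin n) ℝ V)
    (v : Fin n → V) :
    orientationSign o v = orientationSign o b * SignType.sign (b.det v) := by
  obtain ⟨f, -, hf⟩ := exists_alternatingMap_orientationSign o (finrank_eq_card_basis b |>.trans
    (Fintype.card_fin n))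
  rw [hf, hf, ← sign_mul]
  conv_lhs => rw [f.eq_smul_basis_det b]
  rfl

theorem orientationSign_basis_ne_zero (o : VOrientation V) {n : ℕ} (b : Basis (Fin n) ℝ V) :
    orientationSign o b ≠ 0 := by
  obtain ⟨f, hf0, hf⟩ := exists_alternatingMap_orientationSign o (finrank_eq_card_basis b |>.trans
    (Fintype.card_fin n))
  rw [hf, Ne, sign_eq_zero_iff]
  intro h
  refine hf0 ?_
  rw [f.eq_smul_basis_det b, h, zero_smul]

theorem exists_orientationSign_eq {n : ℕ} (h : finrank ℝ V = n) (f : V [⋀^Fin n]→ₗ[ℝ] ℝ)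
    (hf : f ≠ 0) : ∃ o : VOrientation V, ∀ v : Fin n → V,
      orientationSign o v = SignType.sign (f v) := by
  subst h
  refine ⟨rayOfNeZero ℝ f hf, fun v => ?_⟩
  rw [orientationSign, dif_pos rfl]
  have key : SameRay ℝ (rayOfNeZero ℝ f hf).someVector f :=
    (ray_eq_iff (Module.Ray.someVector_ne_zero _) hf).mp (Module.Ray.someVector_ray _)
  obtain ⟨r, hr, h⟩ := key.exists_pos_right (Module.Ray.someVector_ne_zero _) hf
  rw [h]
  change SignType.sign (r * f v) = _
  rw [sign_mul, sign_pos hr, one_mul]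

theorem exists_orientationSign_basis_eq {n : ℕ} (b : Basis (Fin n) ℝ V) {ε : SignType}
    (hε : ε ≠ 0) : ∃ o : VOrientation V, orientationSign o b = ε := by
  have hn : finrank ℝ V = n := (finrank_eq_card_basis b).trans (Fintype.card_fin n)
  have hdet : b.det b = 1 := b.det_self
  have hne : b.det ≠ 0 := fun h => by simp [h] at hdet
  cases ε with
  | zero => exact absurd rfl hε
  | pos =>
    obtain ⟨o, ho⟩ := exists_orientationSign_eq hn b.det hne
    exact ⟨o, by rw [ho, hdet]; simp⟩
  | neg =>
    obtain ⟨o, ho⟩ := exists_orientationSign_eq hn (-b.det) (neg_ne_zero.mpr hne)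
    refine ⟨o, ?_⟩
    rw [ho, AlternatingMap.neg_apply, hdet]
    simp

theorem VOrientation.ext_of_basis {o o' : VOrientation V} {n : ℕ} (b : Basis (Fin n) ℝ V)
    (h : orientationSign o b = orientationSign o' b) : o = o' := by
  have hn : n = finrank ℝ V := ((finrank_eq_card_basis b).trans (Fintype.card_fin n)).symm
  subst hn
  have h0 := orientationSign_basis_ne_zero o' b
  simp only [orientationSign, dif_pos] at h h0
  change SignType.sign (o.someVector b) = SignType.sign (o'.someVector b) at h
  change SignType.sign (o'.someVector b) ≠ 0 at h0
  rw [← Module.Ray.someVector_ray o, ← Module.Ray.someVector_ray o', ray_eq_iff,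
    o.someVector.eq_smul_basis_det b, o'.someVector.eq_smul_basis_det b]
  have hpos : 0 < o.someVector b * o'.someVector b := by
    rw [← sign_eq_one_iff, sign_mul, h]
    revert h0
    generalize SignType.sign (o'.someVector b) = s
    cases s <;> decide
  have hb : o.someVector b ≠ 0 := fun h => by simp [h] at hpos
  have hy : o'.someVector b • b.det =
      (o'.someVector b / o.someVector b) • (o.someVector b • b.det) := by
    rw [smul_smul, div_mul_cancel₀ _ hb]
  rw [hy]
  refine SameRay.sameRay_pos_smul_right _ ?_
  rcases mul_pos_iff.mp hpos with ⟨h1, h2⟩ | ⟨h1, h2⟩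
  · exact div_pos h2 h1
  · exact div_pos_of_neg_of_neg h2 h1

/-- Orientations are transported along linear isomorphisms. -/
theorem exists_orientationSign_comp {W : Type*} [AddCommGroup W] [Module ℝ W]
    [FiniteDimensional ℝ V] (Ψ : V ≃ₗ[ℝ] W) (o : VOrientation V) :
    ∃ o' : VOrientation W, ∀ (n : ℕ) (v : Fin n → V),
      orientationSign o' (fun i => Ψ (v i)) = orientationSign o v := by
  let b := finBasis ℝ V
  obtain ⟨o', ho'⟩ := exists_orientationSign_basis_eq (b.map Ψ) (orientationSign_basis_ne_zero o b)
  refine ⟨o', fun n v => ?_⟩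
  by_cases h : finrank ℝ V = n
  · subst h
    rw [orientationSign_eq_mul_sign_det o' (b.map Ψ), ho', Basis.det_map,
      orientationSign_eq_mul_sign_det o b v]
    congr 3
    ext i
    simp
  · rw [orientationSign_of_finrank_ne o h, orientationSign_of_finrank_ne o' (Ψ.finrank_eq ▸ h)]

end OrientationSign

/-! ### The dual orientation -/

section Dual

variable {V : Type*} [AddCommGroup V] [Module ℝ V]

theorem sign_det_dualBasis {n : ℕ} (b b' : Basis (Fin n) ℝ V) :
    SignType.sign (b.dualBasis.det b'.dualBasis) = SignType.sign (b.det b') := by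
  have h1 : (b.dualBasis.toMatrix b'.dualBasis) = (b'.toMatrix b).transpose := by
    ext i j
    simp [Basis.toMatrix_apply, Basis.dualBasis_repr]
  have h2 : b.det b' * b'.det b = 1 := by
    rw [Basis.det_apply, Basis.det_apply, ← Matrix.det_mul, Basis.toMatrix_mul_toMatrix_flip,
      Matrix.det_one]
  rw [Basis.det_apply, h1, Matrix.det_transpose, ← Basis.det_apply]
  have h3 : SignType.sign (b.det b') * SignType.sign (b'.det b) = 1 := by
    rw [← sign_mul, h2, sign_one]
  revert h3
  generalize SignType.sign (b.det b') = s
  generalize SignType.sign (b'.det b) = t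
  revert s t
  decide

theorem exists_isDualOrientation [FiniteDimensional ℝ V] (o : VOrientation V) :
    ∃ o' : VOrientation (Dual ℝ V), IsDualOrientation o o' := by
  let b := finBasis ℝ V
  obtain ⟨o', ho'⟩ :=
    exists_orientationSign_basis_eq b.dualBasis (orientationSign_basis_ne_zero o b)
  refine ⟨o', fun n c => ?_⟩
  have hn : finrank ℝ V = n := (finrank_eq_card_basis c).trans (Fintype.card_fin n)
  subst hn
  rw [orientationSign_eq_mul_sign_det o' b.dualBasis, orientationSign_eq_mul_sign_det o b c, ho',
    sign_det_dualBasis]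

end Dual

/-! ### Orientations induced through an exact sequence -/

section Induced

variable {A B C E : Type*} [AddCommGroup A] [Module ℝ A] [AddCommGroup B]
  [Module ℝ B] [AddCommGroup C] [Module ℝ C] [AddCommGroup E] [Module ℝ E]

/-- In a short exact sequence `0 → A → B → E → 0`, a basis of the subspace followed by a lift of
a basis of the quotient is a basis of the middle term. -/
theorem exists_basis_sumElim_of_exact {κ₁ κ₂ : Type*} [Fintype κ₁] [Fintype κ₂] {i : A →ₗ[ℝ] B}
    {p : B →ₗ[ℝ] E} (hi : Function.Injective i) (hp : Function.Exact i p)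
    (a : Basis κ₁ ℝ A) (e : Basis κ₂ ℝ E) (y : κ₂ → B) (hy : ∀ j, p (y j) = e j) :
    ∃ b : Basis (κ₁ ⊕ κ₂) ℝ B, ∀ j, b j = Sum.elim (fun j => i (a j)) y j := by
  have li : LinearIndependent ℝ (Sum.elim (fun j => i (a j)) y) := by
    rw [Fintype.linearIndependent_iff]
    intro g hg
    simp only [Fintype.sum_sum_type, Sum.elim_inl, Sum.elim_inr] at hg
    have h2 : ∀ j, g (Sum.inr j) = 0 := by
      have := congrArg p hg
      simp only [map_add, map_sum, map_smul, hp.apply_apply_eq_zero, hy, smul_zero,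
        Finset.sum_const_zero, zero_add, map_zero] at this
      exact Fintype.linearIndependent_iff.mp e.linearIndependent _ this
    have h1 : ∀ j, g (Sum.inl j) = 0 := by
      simp only [h2, zero_smul, Finset.sum_const_zero, add_zero] at hg
      refine Fintype.linearIndependent_iff.mp a.linearIndependent _ (hi ?_)
      simpa using hg
    rintro (j | j)
    exacts [h1 j, h2 j]
  have sp : ⊤ ≤ Submodule.span ℝ (Set.range (Sum.elim (fun j => i (a j)) y)) := by
    intro x _
    have h : p (x - ∑ j, e.repr (p x) j • y j) = 0 := by
      simp [hy, e.sum_repr]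
    obtain ⟨z, hz⟩ := (hp _).mp h
    rw [← sub_add_cancel x (∑ j, e.repr (p x) j • y j), ← hz, ← a.sum_repr z]
    simp only [map_sum, map_smul]
    exact add_mem
      (sum_mem fun j _ => Submodule.smul_mem _ _ (Submodule.subset_span ⟨Sum.inl j, rfl⟩))
      (sum_mem fun j _ => Submodule.smul_mem _ _ (Submodule.subset_span ⟨Sum.inr j, rfl⟩))
  exact ⟨Basis.mk li sp, fun j => by rw [Basis.mk_apply]⟩

theorem Module.Basis.det_eq_mul_of_blocks {κ₁ κ₂ : Type*} [Fintype κ₁] [Fintype κ₂] [DecidableEq κ₁]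
    [DecidableEq κ₂] (b : Basis (κ₁ ⊕ κ₂) ℝ B) (v : κ₁ ⊕ κ₂ → B) (P : Matrix κ₁ κ₁ ℝ)
    (Q : Matrix κ₂ κ₂ ℝ) (h₁ : ∀ r j, b.repr (v (Sum.inl j)) (Sum.inl r) = P r j)
    (h₂ : ∀ r j, b.repr (v (Sum.inl j)) (Sum.inr r) = 0)
    (h₃ : ∀ r j, b.repr (v (Sum.inr j)) (Sum.inr r) = Q r j) : b.det v = P.det * Q.det := by
  rw [Basis.det_apply, ← Matrix.det_fromBlocks_zero₂₁ P
    (Matrix.of fun r j => b.repr (v (Sum.inr j)) (Sum.inl r)) Q]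
  congr 1
  ext r j
  rcases r with r | r <;> rcases j with j | j <;> simp [Basis.toMatrix_apply, h₁, h₂, h₃]

theorem orientationSign_append_eq {k m : ℕ} (o : VOrientation B)
    (b : Basis (Fin k ⊕ Fin m) ℝ B) (u : Fin k → B) (v : Fin m → B) :
    orientationSign o (Fin.append u v) =
      orientationSign o (b.reindex finSumFinEquiv) * SignType.sign (b.det (Sum.elim u v)) := by
  rw [orientationSign_eq_mul_sign_det o (b.reindex finSumFinEquiv), Basis.det_reindex]
  congr 3
  ext (j | j) <;> simp

/-- The defining equation of an induced orientation, imposed for one choice of bases and lifts, holds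
for all choices: with `P`, `Q`, `R` the change of basis in `A`, in the range of `f` and in `E`, the
two middle terms change by the block triangular determinants `det P * det Q` and `det Q * det R`. -/
theorem exists_isInducedOrientation [FiniteDimensional ℝ A] [FiniteDimensional ℝ C]
    [FiniteDimensional ℝ E] {i : A →ₗ[ℝ] B} {f : B →ₗ[ℝ] C} {p : C →ₗ[ℝ] E}
    (hi : Function.Injective i) (hf : Function.Exact i f) (hp : Function.Exact f p)
    (hs : Function.Surjective p) (oA : VOrientation A) (oC : VOrientation C)
    (oE : VOrientation E) :
    ∃ oB : VOrientation B, IsInducedOrientation i f p oA oB oC oE := by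
  let a₀ := finBasis ℝ A
  let e₀ := finBasis ℝ E
  let d₀ := finBasis ℝ (LinearMap.range f)
  have hx₀ : ∀ j, ∃ x, f.rangeRestrict x = d₀ j := fun j =>
    LinearMap.surjective_rangeRestrict f (d₀ j)
  choose x₀ hx₀ using hx₀
  choose y₀ hy₀ using fun j => hs (e₀ j)
  have hf' : Function.Exact i f.rangeRestrict := fun x => by
    rw [← hf x, Subtype.ext_iff]; rfl
  have hp' : Function.Exact (LinearMap.range f).subtype p := fun x => by
    rw [hp x]; simp
  obtain ⟨bB, hB⟩ := exists_basis_sumElim_of_exact hi hf' a₀ d₀ x₀ hx₀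
  obtain ⟨bC, hC⟩ := exists_basis_sumElim_of_exact (Submodule.subtype_injective _) hp' d₀ e₀ y₀ hy₀
  have hfx₀ : ∀ j, f (x₀ j) = d₀ j := fun j => congrArg Subtype.val (hx₀ j)
  have hε : orientationSign oA a₀ * orientationSign oE e₀ *
      orientationSign oC (bC.reindex finSumFinEquiv) ≠ 0 :=
    mul_ne_zero (mul_ne_zero (orientationSign_basis_ne_zero _ _)
      (orientationSign_basis_ne_zero _ _)) (orientationSign_basis_ne_zero _ _)
  obtain ⟨oB, hoB⟩ := exists_orientationSign_basis_eq (bB.reindex finSumFinEquiv) hε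
  refine ⟨oB, fun k l m a e x y hy => ?_⟩
  have hk : finrank ℝ A = k := (finrank_eq_card_basis a).trans (Fintype.card_fin k)
  have hl : finrank ℝ E = l := (finrank_eq_card_basis e).trans (Fintype.card_fin l)
  subst hk hl
  have hBdim : finrank ℝ B = finrank ℝ A + finrank ℝ (LinearMap.range f) := by
    rw [finrank_eq_card_basis bB]; simp
  have hCdim : finrank ℝ C = finrank ℝ (LinearMap.range f) + finrank ℝ E := by
    rw [finrank_eq_card_basis bC]; simp
  -- Sequences of the wrong length have sign zero on both sides.
  by_cases hm : finrank ℝ (LinearMap.range f) = m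
  swap
  · rw [orientationSign_of_finrank_ne oB (by omega), orientationSign_of_finrank_ne oC (by omega),
      mul_zero]
  subst hm
  -- The matrix of the images of the `x j` in the range of `f`; it enters both determinants.
  set Q : Matrix (Fin (finrank ℝ (LinearMap.range f))) (Fin (finrank ℝ (LinearMap.range f))) ℝ :=
    Matrix.of fun r j => bB.repr (x j) (Sum.inr r) with hQ
  have hiz : ∀ z, i z = ∑ r, a₀.repr z r • bB (Sum.inl r) := fun z => by
    conv_lhs => rw [← a₀.sum_repr z, map_sum]
    simp only [map_smul, hB, Sum.elim_inl]
  have detB : bB.det (Sum.elim (fun j => i (a j)) x) = a₀.det a * Q.det := by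
    rw [Basis.det_apply a₀]
    refine bB.det_eq_mul_of_blocks _ _ _ (fun r j => ?_) (fun r j => ?_) (fun r j => rfl)
    · rw [Sum.elim_inl, hiz]
      simp [Finsupp.single_apply, Basis.toMatrix_apply]
    · rw [Sum.elim_inl, hiz]
      simp
  have detC : bC.det (Sum.elim (fun j => f (x j)) y) = Q.det * e₀.det e := by
    rw [Basis.det_apply e₀]
    have hfx : ∀ z, f z = ∑ r, bB.repr z (Sum.inr r) • bC (Sum.inl r) := fun z => by
      conv_lhs => rw [← bB.sum_repr z]
      simp [hB, hC, hf.apply_apply_eq_zero, hfx₀]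
    refine bC.det_eq_mul_of_blocks _ _ _ (fun r j => ?_) (fun r j => ?_) (fun r j => ?_)
    · rw [Sum.elim_inl, hfx]
      simp [hQ, Finsupp.single_apply]
    · rw [Sum.elim_inl, hfx]
      simp
    · rw [Sum.elim_inr, Basis.toMatrix_apply, ← hy]
      have : p (y j) = ∑ r, bC.repr (y j) (Sum.inr r) • e₀ r := by
        conv_lhs => rw [← bC.sum_repr (y j)]
        have h0 : ∀ z : LinearMap.range f, p z = 0 := hp'.apply_apply_eq_zero
        simp [hC, h0, hy₀]
      rw [this]
      simp [Finsupp.single_apply]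
  rw [orientationSign_append_eq oB bB, orientationSign_append_eq oC bC, detB, detC, hoB,
    orientationSign_eq_mul_sign_det oA a₀ a, orientationSign_eq_mul_sign_det oE e₀ e,
    sign_mul, sign_mul]
  have he : SignType.sign (e₀.det e) * SignType.sign (e₀.det e) = 1 := by
    have := orientationSign_basis_ne_zero oE e
    rw [orientationSign_eq_mul_sign_det oE e₀ e] at this
    revert this
    generalize SignType.sign (e₀.det e) = s
    generalize orientationSign oE e₀ = t
    revert s t
    decide
  rw [← mul_one (_ * _ * _ * (_ * _)), ← he]
  generalize SignType.sign (e₀.det e) = s, SignType.sign (a₀.det a) = t, SignType.sign Q.det = u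
  ac_rfl

theorem IsInducedOrientation.unique [FiniteDimensional ℝ A] [FiniteDimensional ℝ C]
    [FiniteDimensional ℝ E] {i : A →ₗ[ℝ] B} {f : B →ₗ[ℝ] C} {p : C →ₗ[ℝ] E}
    (hi : Function.Injective i) (hf : Function.Exact i f) (hs : Function.Surjective p)
    {oA : VOrientation A} {oC : VOrientation C} {oE : VOrientation E} {oB oB' : VOrientation B}
    (h : IsInducedOrientation i f p oA oB oC oE) (h' : IsInducedOrientation i f p oA oB' oC oE) :
    oB = oB' := by
  let d₀ := finBasis ℝ (LinearMap.range f)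
  choose x₀ hx₀ using fun j => LinearMap.surjective_rangeRestrict f (d₀ j)
  choose y₀ hy₀ using fun j => hs (finBasis ℝ E j)
  have hf' : Function.Exact i f.rangeRestrict := fun x => by
    rw [← hf x, Subtype.ext_iff]; rfl
  obtain ⟨b, hb⟩ := exists_basis_sumElim_of_exact hi hf' (finBasis ℝ A) d₀ x₀ hx₀
  refine VOrientation.ext_of_basis (b.reindex finSumFinEquiv) ?_
  have : ⇑(b.reindex finSumFinEquiv) = Fin.append (fun j => i (finBasis ℝ A j)) x₀ := by
    ext j
    obtain ⟨j, rfl⟩ := finSumFinEquiv.surjective j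
    rcases j with j | j <;> simp [hb]
  rw [this, h _ _ _ _ _ _ _ hy₀, h' _ _ _ _ _ _ _ hy₀]

end Induced

/-! ### The orientation induced by a symplectic form -/

section Symplectic

variable {V : Type*} [AddCommGroup V] [Module ℝ V]

theorem prod_pair_update (ω : LinearMap.BilinForm ℝ V) {g : ℕ} (v : Fin (g * 2) → V) (i₀ : Fin g)
    (s : Fin 2) (z : V) :
    ∏ i : Fin g, ω (Function.update v (finProdFinEquiv (i₀, s)) z (finProdFinEquiv (i, 0)))
        (Function.update v (finProdFinEquiv (i₀, s)) z (finProdFinEquiv (i, 1))) =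
      ω (Function.update v (finProdFinEquiv (i₀, s)) z (finProdFinEquiv (i₀, 0)))
          (Function.update v (finProdFinEquiv (i₀, s)) z (finProdFinEquiv (i₀, 1))) *
        ∏ i ∈ Finset.univ.erase i₀, ω (v (finProdFinEquiv (i, 0))) (v (finProdFinEquiv (i, 1))) := by
  rw [← Finset.mul_prod_erase Finset.univ _ (Finset.mem_univ i₀)]
  congr 1
  refine Finset.prod_congr rfl fun i hi => ?_
  rw [Function.update_of_ne, Function.update_of_ne] <;> simp [(Finset.mem_erase.mp hi).1]

/-- The form `v ↦ ∏ i, ω(v₂ᵢ, v₂ᵢ₊₁)`, whose alternatization is `formPower ω g`. -/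
def pairProduct (ω : LinearMap.BilinForm ℝ V) (g : ℕ) :
    MultilinearMap ℝ (fun _ : Fin (g * 2) => V) ℝ where
  toFun v := ∏ i : Fin g, ω (v (finProdFinEquiv (i, 0))) (v (finProdFinEquiv (i, 1)))
  map_update_add' := by
    intro inst v j x y
    obtain rfl := Subsingleton.elim (instDecidableEqFin _) inst
    obtain ⟨⟨i₀, s⟩, rfl⟩ := finProdFinEquiv.surjective j
    simp only [prod_pair_update, ← add_mul]
    fin_cases s <;> simp
  map_update_smul' := by
    intro inst v j r x
    obtain rfl := Subsingleton.elim (instDecidableEqFin _) inst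
    obtain ⟨⟨i₀, s⟩, rfl⟩ := finProdFinEquiv.surjective j
    simp only [prod_pair_update, smul_eq_mul, ← mul_assoc]
    fin_cases s <;> simp

theorem alternatization_pairProduct (ω : LinearMap.BilinForm ℝ V) (g : ℕ) (v : Fin (g * 2) → V) :
    MultilinearMap.alternatization (pairProduct ω g) v = formPower ω g v := by
  rw [MultilinearMap.alternatization_apply]
  refine Finset.sum_congr rfl fun π _ => ?_
  rw [Units.smul_def, zsmul_eq_mul]
  rfl

/-- The terms of `ω ∧ ⋯ ∧ ω` on a symplectic basis are nonnegative: exchanging the members of a pair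
changes the sign of the permutation and that of the factor. -/
theorem sign_mul_prod_nonneg_of_symplectic (ω : LinearMap.BilinForm ℝ V) (hω : ω.IsAlt) {g : ℕ}
    (w : Fin g × Fin 2 → V) (h₀ : ∀ i j, ω (w (i, 0)) (w (j, 0)) = 0)
    (h₁ : ∀ i j, ω (w (i, 1)) (w (j, 1)) = 0)
    (h₀₁ : ∀ i j, ω (w (i, 0)) (w (j, 1)) = if i = j then 1 else 0)
    (ρ : Equiv.Perm (Fin g × Fin 2)) :
    0 ≤ ((Equiv.Perm.sign ρ : ℤ) : ℝ) * ∏ i, ω (w (ρ (i, 0))) (w (ρ (i, 1))) := by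
  have h₁₀ : ∀ i j, ω (w (i, 1)) (w (j, 0)) = if i = j then -1 else 0 := fun i j => by
    rw [← hω.neg_eq, h₀₁]
    by_cases h : i = j <;> simp [h, eq_comm]
  by_cases hne : ∏ i, ω (w (ρ (i, 0))) (w (ρ (i, 1))) = 0
  · rw [hne, mul_zero]
  -- A non-vanishing term permutes the hyperbolic pairs, and then each pair.
  have hfst : ∀ i, (ρ (i, 0)).1 = (ρ (i, 1)).1 := fun i => by
    have hi := Finset.prod_ne_zero_iff.mp hne i (Finset.mem_univ i)
    generalize ρ (i, 0) = p at hi ⊢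
    generalize ρ (i, 1) = q at hi ⊢
    obtain ⟨a, s⟩ := p
    obtain ⟨b, t⟩ := q
    by_contra hab
    change a ≠ b at hab
    fin_cases s <;> fin_cases t <;> simp [h₀, h₁, h₀₁, h₁₀, hab] at hi
  have hfst' : ∀ i s, (ρ (i, s)).1 = (ρ (i, 0)).1 := fun i s => by
    fin_cases s
    exacts [rfl, (hfst i).symm]
  have hσ : Function.Surjective fun i => (ρ (i, 0)).1 := fun j => by
    obtain ⟨⟨i, s⟩, h⟩ := ρ.surjective (j, 0)
    exact ⟨i, by change (ρ (i, 0)).1 = j; rw [← hfst' i s, h]⟩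
  let σ : Equiv.Perm (Fin g) := Equiv.ofBijective _ (Finite.injective_iff_bijective.mp
    (Finite.injective_iff_surjective.mpr hσ))
  have hτ : ∀ i, Function.Injective fun s => (ρ (i, s)).2 := fun i s t h => by
    have : ρ (i, s) = ρ (i, t) := Prod.ext ((hfst' i s).trans (hfst' i t).symm) h
    exact congrArg Prod.snd (ρ.injective this)
  let τ : Fin g → Equiv.Perm (Fin 2) := fun i => Equiv.ofBijective _
    (Finite.injective_iff_bijective.mp (hτ i))
  have hρ : ρ = Equiv.prodCongrLeft (fun _ => σ) * Equiv.prodCongrRight τ := by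
    ext1 ⟨i, s⟩
    exact Prod.ext (hfst' i s) rfl
  have hsign : Equiv.Perm.sign ρ = ∏ i, Equiv.Perm.sign (τ i) := by
    rw [hρ, Equiv.Perm.sign_mul, Equiv.Perm.sign_prodCongrLeft, Equiv.Perm.sign_prodCongrRight]
    simp
  have hterm : ∀ i, ω (w (ρ (i, 0))) (w (ρ (i, 1))) = ((Equiv.Perm.sign (τ i) : ℤ) : ℝ) := fun i => by
    have h : ∀ s, ρ (i, s) = (σ i, τ i s) := fun s => by rw [hρ]; rfl
    rw [h, h]
    generalize τ i = t
    have ht : t = 1 ∨ t = Equiv.swap 0 1 := by revert t; decide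
    rcases ht with rfl | rfl <;> simp [h₀₁, h₁₀]
  simp only [hterm]
  rw [hsign, Units.coe_prod, Int.cast_prod, ← Finset.prod_mul_distrib]
  exact Finset.prod_nonneg fun i _ => mul_self_nonneg _

/-- On a symplectic basis, all terms of `ω ∧ ⋯ ∧ ω` are nonnegative and that of the identity
permutation is `1`. -/
theorem formPower_pos_of_symplectic (ω : LinearMap.BilinForm ℝ V) (hω : ω.IsAlt) {g : ℕ}
    (w : Fin g × Fin 2 → V) (h₀ : ∀ i j, ω (w (i, 0)) (w (j, 0)) = 0)
    (h₁ : ∀ i j, ω (w (i, 1)) (w (j, 1)) = 0)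
    (h₀₁ : ∀ i j, ω (w (i, 0)) (w (j, 1)) = if i = j then 1 else 0) :
    0 < formPower ω g (w ∘ finProdFinEquiv.symm) := by
  refine Finset.sum_pos' (fun π _ => ?_) ⟨1, Finset.mem_univ _, ?_⟩
  · have h := sign_mul_prod_nonneg_of_symplectic ω hω w h₀ h₁ h₀₁
      (finProdFinEquiv.symm.permCongr π)
    rw [Equiv.Perm.sign_permCongr] at h
    exact h
  · simp [h₀₁]

/-- A basis of an isotropic subspace extends to a symplectic family. -/
theorem exists_symplectic_family [FiniteDimensional ℝ V] (ω : LinearMap.BilinForm ℝ V)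
    (hω : ω.IsAlt) (hnd : ω.Nondegenerate) {g : ℕ} {x : Fin g → V} (hx : LinearIndependent ℝ x)
    (hx0 : ∀ i j, ω (x i) (x j) = 0) :
    ∃ y : Fin g → V,
      (∀ i j, ω (y i) (y j) = 0) ∧ ∀ i j, ω (y i) (x j) = if i = j then 1 else 0 := by
  have h : ∀ i, ∃ z, ∀ j, ω z (x j) = if i = j then 1 else 0 := fun i => by
    obtain ⟨φ, hφ⟩ := LinearMap.exists_extend ((Basis.span hx).coord i)
    refine ⟨(ω.toDual hnd).symm φ, fun j => ?_⟩
    rw [LinearMap.BilinForm.apply_toDual_symm_apply]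
    have := LinearMap.congr_fun hφ (Basis.span hx j)
    rw [Basis.coord_apply, Basis.repr_self, Finsupp.single_apply] at this
    rw [eq_comm, ← if_congr (eq_comm (a := j)) rfl rfl, ← this]
    simp [Basis.span_apply]
  choose z hz using h
  have hxz : ∀ i j, ω (x i) (z j) = if i = j then -1 else 0 := fun i j => by
    rw [← hω.neg_eq, hz]
    by_cases h : i = j <;> simp [h, eq_comm]
  -- The correction by half of the Gram matrix makes the `z i` orthogonal to each other.
  refine ⟨fun i => z i + (2⁻¹ : ℝ) • ∑ k, ω (z i) (z k) • x k, fun i j => ?_, fun i j => ?_⟩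
  · simp only [map_add, map_smul, map_sum, LinearMap.add_apply, LinearMap.smul_apply,
      LinearMap.sum_apply, hz, hxz, hx0, smul_eq_mul]
    simp only [add_zero, mul_ite, mul_one, mul_zero, mul_neg, Finset.sum_ite_eq, Finset.sum_ite_eq',
      Finset.mem_univ, if_true, Finset.sum_const_zero]
    rw [← hω.neg_eq (z i) (z j)]
    ring
  · simp only [map_add, map_smul, map_sum, LinearMap.add_apply, LinearMap.smul_apply,
      LinearMap.sum_apply, hz, hx0, smul_zero, Finset.sum_const_zero, add_zero]

theorem exists_isSymplecticOrientation [FiniteDimensional ℝ V] (ω : LinearMap.BilinForm ℝ V)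
    (hω : ω.IsAlt) (hnd : ω.Nondegenerate) {g : ℕ} (hg : finrank ℝ V = g * 2) {x : Fin g → V}
    (hx : LinearIndependent ℝ x) (hx0 : ∀ i j, ω (x i) (x j) = 0) :
    ∃ o : VOrientation V, IsSymplecticOrientation ω o := by
  obtain ⟨y, hy0, hyx⟩ := exists_symplectic_family ω hω hnd hx hx0
  have hpos := formPower_pos_of_symplectic ω hω (fun p => if p.2 = 0 then y p.1 else x p.1)
    (by simpa using hy0) (by simpa using hx0) (by simpa using hyx)
  rw [← alternatization_pairProduct] at hpos
  obtain ⟨o, ho⟩ := exists_orientationSign_eq hg (MultilinearMap.alternatization (pairProduct ω g))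
    (fun h => by rw [h] at hpos; exact lt_irrefl _ hpos)
  exact ⟨o, g, hg, fun v => by rw [ho, alternatization_pairProduct]⟩

theorem IsSymplecticOrientation.unique [FiniteDimensional ℝ V] {ω : LinearMap.BilinForm ℝ V}
    {o o' : VOrientation V} (h : IsSymplecticOrientation ω o) (h' : IsSymplecticOrientation ω o') :
    o = o' := by
  obtain ⟨g, hg, h⟩ := h
  obtain ⟨g', hg', h'⟩ := h'
  obtain rfl : g = g' := by omega
  refine VOrientation.ext_of_basis ((finBasis ℝ V).reindex (finCongr hg)) ?_
  rw [h, h']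

theorem IsDualOrientation.unique [FiniteDimensional ℝ V] {o : VOrientation V}
    {o₁ o₂ : VOrientation (Dual ℝ V)} (h₁ : IsDualOrientation o o₁) (h₂ : IsDualOrientation o o₂) :
    o₁ = o₂ :=
  VOrientation.ext_of_basis (finBasis ℝ V).dualBasis (by rw [h₁, h₂])

end Symplectic

/-! ### Orientations induced by a symplectic form and a self-dual exact sequence -/

section Casson

variable {A B V : Type*} [AddCommGroup A] [Module ℝ A] [AddCommGroup B] [Module ℝ B]
  [AddCommGroup V] [Module ℝ V]

/-- The orientation `o` of `B` is induced through an exact sequence `0 → A → B → V → A^* → 0` by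
the form `ω` on `V`, for either orientation of `A` and its dual orientation of `A^*`.
`IsCassonOrientation` is the case of the sequence of a Heegaard diagram. -/
def IsSymplecticallyInduced (ω : LinearMap.BilinForm ℝ V) (i : A →ₗ[ℝ] B) (f : B →ₗ[ℝ] V)
    (p : V →ₗ[ℝ] Dual ℝ A) (o : VOrientation B) : Prop :=
  ∀ oA : VOrientation A, ∃ (oE : VOrientation (Dual ℝ A)) (oV : VOrientation V),
    IsDualOrientation oA oE ∧ IsSymplecticOrientation ω oV ∧ IsInducedOrientation i f p oA o oV oE

theorem exists_vOrientation (W : Type*) [AddCommGroup W] [Module ℝ W] [FiniteDimensional ℝ W] :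
    Nonempty (VOrientation W) :=
  let ⟨o, _⟩ := exists_orientationSign_basis_eq (finBasis ℝ W) (ε := 1) one_ne_zero
  ⟨o⟩

theorem signType_mul_self {s : SignType} (hs : s ≠ 0) : s * s = 1 := by
  revert hs
  revert s
  decide

/-- The product of the orientation of `A` and the dual orientation of `A^*` does not depend on the
orientation of `A`. -/
theorem IsDualOrientation.mul_eq {n l : ℕ} {o : VOrientation A} {o' : VOrientation (Dual ℝ A)}
    (h : IsDualOrientation o o') (b a : Basis (Fin n) ℝ A) (e : Basis (Fin l) ℝ (Dual ℝ A))
    (hl : l = n) :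
    orientationSign o a * orientationSign o' e =
      SignType.sign (b.det a) * SignType.sign (b.dualBasis.det (e ∘ Fin.cast hl.symm)) := by
  subst hl
  rw [orientationSign_eq_mul_sign_det o b a, orientationSign_eq_mul_sign_det o' b.dualBasis e,
    h, mul_mul_mul_comm, signType_mul_self (orientationSign_basis_ne_zero o b), one_mul]
  rfl

theorem existsUnique_isSymplecticallyInduced [FiniteDimensional ℝ A] [FiniteDimensional ℝ V]
    {ω : LinearMap.BilinForm ℝ V} {i : A →ₗ[ℝ] B} {f : B →ₗ[ℝ] V} {p : V →ₗ[ℝ] Dual ℝ A}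
    (hi : Function.Injective i) (hf : Function.Exact i f) (hp : Function.Exact f p)
    (hs : Function.Surjective p) {oV : VOrientation V} (hV : IsSymplecticOrientation ω oV) :
    ∃! o : VOrientation B, IsSymplecticallyInduced ω i f p o := by
  obtain ⟨oA⟩ := exists_vOrientation A
  obtain ⟨oE, hE⟩ := exists_isDualOrientation oA
  obtain ⟨o, ho⟩ := exists_isInducedOrientation hi hf hp hs oA oV oE
  refine ⟨o, fun oA' => ?_, fun o' ho' => ?_⟩
  · obtain ⟨oE', hE'⟩ := exists_isDualOrientation oA'
    refine ⟨oE', oV, hE', hV, fun k l m a e x y hy => ?_⟩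
    have hk : l = k := by
      rw [← Fintype.card_fin k, ← Fintype.card_fin l, ← finrank_eq_card_basis a,
        ← finrank_eq_card_basis e, Subspace.dual_finrank_eq]
    rw [ho _ _ _ _ _ _ _ hy, hE.mul_eq a a e hk, hE'.mul_eq a a e hk]
  · obtain ⟨oE', oV', hE', hV', hind⟩ := ho' oA
    rw [hE'.unique hE, hV'.unique hV] at hind
    exact hind.unique hi hf hs ho

/-- An isomorphism of exact sequences that preserves the forms transports the induced
orientation. -/
theorem IsSymplecticallyInduced.exists_comp {A' B' V' : Type*} [AddCommGroup A'] [Module ℝ A']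
    [AddCommGroup B'] [Module ℝ B'] [AddCommGroup V'] [Module ℝ V'] [FiniteDimensional ℝ A]
    [FiniteDimensional ℝ B] [FiniteDimensional ℝ V]
    {ω : LinearMap.BilinForm ℝ V} {i : A →ₗ[ℝ] B} {f : B →ₗ[ℝ] V} {p : V →ₗ[ℝ] Dual ℝ A}
    {ω' : LinearMap.BilinForm ℝ V'} {i' : A' →ₗ[ℝ] B'} {f' : B' →ₗ[ℝ] V'}
    {p' : V' →ₗ[ℝ] Dual ℝ A'} (α : A ≃ₗ[ℝ] A') (β : B ≃ₗ[ℝ] B') (γ : V ≃ₗ[ℝ] V')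
    (hi : ∀ z, β (i z) = i' (α z)) (hf : ∀ z, γ (f z) = f' (β z))
    (hp : ∀ x z, p' (γ x) (α z) = p x z) (hω : ∀ x y, ω' (γ x) (γ y) = ω x y)
    {o : VOrientation B} (ho : IsSymplecticallyInduced ω i f p o) :
    ∃ o' : VOrientation B', IsSymplecticallyInduced ω' i' f' p' o' ∧
      ∀ (n : ℕ) (v : Fin n → B), orientationSign o' (fun j => β (v j)) = orientationSign o v := by
  obtain ⟨o', ho'⟩ := exists_orientationSign_comp β o
  have : FiniteDimensional ℝ A' := α.finiteDimensional
  refine ⟨o', fun oA' => ?_, ho'⟩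
  obtain ⟨oA, hA⟩ := exists_orientationSign_comp α.symm oA'
  obtain ⟨oE, oV, hE, hV, hind⟩ := ho oA
  let ε : Dual ℝ A ≃ₗ[ℝ] Dual ℝ A' := α.symm.dualMap
  obtain ⟨oE', hE'⟩ := exists_orientationSign_comp ε oE
  obtain ⟨oV', hV'⟩ := exists_orientationSign_comp γ oV
  refine ⟨oE', oV', fun n b' => ?_, ?_, fun k l m a' e' x' y' hy' => ?_⟩
  · have : (b'.dualBasis : Fin n → Dual ℝ A') = fun j => ε ((b'.map α.symm).dualBasis j) := by
      ext1 j
      refine b'.ext fun r => ?_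
      simp [ε, LinearEquiv.dualMap_apply]
    rw [this, hE', hE, ← hA]
    rfl
  · obtain ⟨g, hg, h⟩ := hV
    refine ⟨g, γ.finrank_eq ▸ hg, fun v => ?_⟩
    have hv : v = fun j => γ (γ.symm (v j)) := by simp
    rw [hv, hV', h]
    simp only [formPower, hω]
  · have hya : ∀ j, p (γ.symm (y' j)) = (e'.map ε.symm) j := fun j => by
      rw [Basis.map_apply, ← hy', LinearEquiv.eq_symm_apply]
      refine LinearMap.ext fun z => ?_
      rw [LinearEquiv.dualMap_apply, ← hp]
      simp
    have h := hind k l m (a'.map α.symm) (e'.map ε.symm) (fun j => β.symm (x' j))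
      (fun j => γ.symm (y' j)) hya
    rw [← ho', ← hV', ← hE'] at h
    have h1 : (fun j => β (Fin.append (fun j => i ((a'.map α.symm) j)) (fun j => β.symm (x' j)) j)) =
        Fin.append (fun j => i' (a' j)) x' := by
      ext j
      refine Fin.addCases (fun j => ?_) (fun j => ?_) j <;> simp [hi]
    have h2 : (fun j => γ (Fin.append (fun j => f (β.symm (x' j))) (fun j => γ.symm (y' j)) j)) =
        Fin.append (fun j => f' (x' j)) y' := by
      ext j
      refine Fin.addCases (fun j => ?_) (fun j => ?_) j <;> simp [hf]
    have h3 : (fun j => ε ((e'.map ε.symm) j)) = e' := by ext1 j; simp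
    have h4 : orientationSign oA (a'.map α.symm) = orientationSign oA' a' := by
      rw [← hA]; rfl
    rw [h1, h2, h3, h4] at h
    exact h

/-- The induced orientation of the zero space is the positive one. -/
theorem IsSymplecticallyInduced.orientationSign_eq_one [FiniteDimensional ℝ A]
    [FiniteDimensional ℝ B] [FiniteDimensional ℝ V]
    {ω : LinearMap.BilinForm ℝ V} {i : A →ₗ[ℝ] B} {f : B →ₗ[ℝ] V} {p : V →ₗ[ℝ] Dual ℝ A}
    {o : VOrientation B} (ho : IsSymplecticallyInduced ω i f p o) (hA : finrank ℝ A = 0)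
    (hV : finrank ℝ V = 0) {n : ℕ} (hn : n = 0) (v : Fin n → B) : orientationSign o v = 1 := by
  subst hn
  obtain ⟨oA⟩ := exists_vOrientation A
  obtain ⟨oE, oV, hE, ⟨g, hg, hoV⟩, hind⟩ := ho oA
  obtain rfl : g = 0 := by omega
  let a : Basis (Fin 0) ℝ A := (finBasis ℝ A).reindex (finCongr hA)
  have h := hind 0 0 0 a a.dualBasis v Fin.elim0 (fun j => j.elim0)
  rw [hE, signType_mul_self (orientationSign_basis_ne_zero oA a), one_mul] at h
  have hv : Fin.append (fun j => i (a j)) v = v := funext fun j => Fin.elim0 j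
  rw [hv] at h
  refine h.trans ((hoV _).trans ?_)
  simp [formPower]

end Casson

/-! ### The intersection form is symplectic -/

namespace CellSurface

section IntersectionForm

variable {Dart : Type*} (M : CellSurface Dart)

theorem rot_face (d : Dart) : M.rot (M.face d) = M.rev d := by simp [face]

variable [Fintype Dart]

theorem intersectionForm_mk (a b : M.cycles) :
    M.intersectionForm (Submodule.Quotient.mk a) (Submodule.Quotient.mk b) =
      M.chainPairing a b := rfl

theorem mk_eq_mk_iff (a b : M.cycles) :
    (Submodule.Quotient.mk a : M.H1) = Submodule.Quotient.mk b ↔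
      (a - b : Dart → ℝ) ∈ M.boundaries :=
  Submodule.Quotient.eq _

theorem intersectionForm_isAlt : M.intersectionForm.IsAlt := by
  intro x
  obtain ⟨a, rfl⟩ := Submodule.Quotient.mk_surjective _ x
  rw [intersectionForm_mk]
  linarith [M.chainPairing_neg a.2 a.2]

theorem chainPairing_apply (a b : Dart → ℝ) :
    M.chainPairing a b = - ∑ d, a d * ((M.potential b d + M.potential b (M.rot d)) / 2) := rfl

open Classical in
/-- A functional on chains that vanishes on the cycles is the sum of a symmetric function and of
a function `u` of the initial vertex; antisymmetrization eliminates the first one. -/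
theorem exists_eq_of_sum_mul_cycles_eq_zero (h : Dart → ℝ)
    (hh : ∀ a ∈ M.cycles, ∑ d, a d * h d = 0) :
    ∃ u : Dart → ℝ, (∀ d, u (M.rot d) = u d) ∧
      ∀ d, h d - h (M.rev d) = u d - u (M.rev d) := by
  let π : Dart → (Dart → ℝ) →ₗ[ℝ] ℝ := fun d => LinearMap.proj d
  let L : Dart ⊕ Dart → (Dart → ℝ) →ₗ[ℝ] ℝ :=
    Sum.elim (fun d => π (M.rev d) + π d) (fun d => ∑ x with M.SameVertex d x, π x)
  let K : (Dart → ℝ) →ₗ[ℝ] ℝ := ∑ d, h d • π d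
  have hK : K ∈ Submodule.span ℝ (Set.range L) := by
    refine mem_span_of_iInf_ker_le_ker fun a ha => ?_
    simp only [Submodule.mem_iInf, LinearMap.mem_ker] at ha
    have hcyc : a ∈ M.cycles := by
      refine ⟨fun d => eq_neg_of_add_eq_zero_left (ha (Sum.inl d)), fun d => ?_⟩
      have := ha (Sum.inr d)
      simpa [L, π] using this
    rw [LinearMap.mem_ker, ← hh a hcyc]
    simp [K, π, mul_comm]
  obtain ⟨c, hc⟩ := (Submodule.mem_span_range_iff_exists_fun ℝ).mp hK
  refine ⟨fun x => ∑ d, if M.SameVertex d x then c (Sum.inr d) else 0, fun x => ?_, fun x => ?_⟩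
  · refine Finset.sum_congr rfl fun d _ => ?_
    have : M.SameVertex d (M.rot x) ↔ M.SameVertex d x := Equiv.Perm.sameCycle_apply_right
    simp only [this]
  · have hx : ∀ x, h x = c (Sum.inl (M.rev x)) + c (Sum.inl x) +
        ∑ d, if M.SameVertex d x then c (Sum.inr d) else 0 := fun x => by
      have := LinearMap.congr_fun hc (Pi.single x 1)
      have hrev : ∀ d, M.rev d = x ↔ d = M.rev x := fun d =>
        ⟨fun h => by rw [← h, M.rev_rev], fun h => by rw [h, M.rev_rev]⟩
      simp only [Fintype.sum_sum_type, L, K, π, Sum.elim_inl, Sum.elim_inr, LinearMap.add_apply,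
        LinearMap.sum_apply, LinearMap.smul_apply, LinearMap.proj_apply, Pi.single_apply,
        smul_eq_mul, hrev, mul_add, mul_ite, mul_one, mul_zero, Finset.sum_add_distrib,
        Finset.sum_ite_eq', Finset.mem_univ, if_true, Finset.sum_filter] at this
      rw [← this]
      congr 1
      refine Finset.sum_congr rfl fun d _ => ?_
      rw [Finset.sum_eq_single x (fun y _ hy => ?_) (by simp)]
      · split_ifs <;> simp
      · split_ifs <;> simp [hy]
    rw [hx x, hx (M.rev x), M.rev_rev]
    ring

/-- Poincaré duality: a cycle that pairs to zero with all cycles is a boundary. Its potential,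
corrected by a function on the vertices, is constant on the faces. -/
theorem mem_boundaries_of_chainPairing_eq_zero {b : Dart → ℝ} (hb : b ∈ M.cycles)
    (h : ∀ a ∈ M.cycles, M.chainPairing a b = 0) : b ∈ M.boundaries := by
  obtain ⟨u, hu, hu'⟩ := M.exists_eq_of_sum_mul_cycles_eq_zero
    (fun d => (M.potential b d + M.potential b (M.rot d)) / 2)
    (fun a ha => by rw [← neg_eq_zero, ← chainPairing_apply, h a ha])
  have hP : ∀ d, M.potential b (M.rot d) - u (M.rot d) =
      M.potential b (M.rev d) - u (M.rev d) := fun d => by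
    have h1 := hu' d
    simp only [M.potential_rot hb, hb.1 d] at h1
    rw [hu, M.potential_rot hb]
    linarith
  refine ⟨fun d => M.potential b (M.rot d) - u (M.rot d), fun d => ?_, ?_⟩
  · simp only [rot_face, hP]
  · ext d
    simp only [bdry, LinearMap.coe_mk, AddHom.coe_mk]
    rw [hP (M.rev d), M.rev_rev, hu, M.potential_rot hb]
    ring

theorem intersectionForm_nondegenerate : M.intersectionForm.Nondegenerate := by
  have hr : M.intersectionForm.SeparatingRight := fun x hx => by
    obtain ⟨⟨b, hb⟩, rfl⟩ := Submodule.Quotient.mk_surjective _ x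
    refine (Submodule.Quotient.mk_eq_zero _).mpr ?_
    exact M.mem_boundaries_of_chainPairing_eq_zero hb fun a ha =>
      hx (Submodule.Quotient.mk ⟨a, ha⟩)
  refine ⟨fun x hx => hr x fun y => ?_, hr⟩
  rw [← M.intersectionForm_isAlt.neg_eq, hx, neg_zero]

end IntersectionForm

/-! ### The first Betti number -/

section Betti

variable {Dart : Type*} (M : CellSurface Dart)

/-- The orbits of a permutation. -/
abbrev Orbits {α : Type*} (π : Equiv.Perm α) : Type _ := Quotient (Equiv.Perm.SameCycle.setoid π)

/-- The orbit of an element. -/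
abbrev toOrbit {α : Type*} (π : Equiv.Perm α) (x : α) : Orbits π :=
  Quotient.mk (Equiv.Perm.SameCycle.setoid π) x

theorem toOrbit_apply {α : Type*} (π : Equiv.Perm α) (x : α) :
    toOrbit π (π x) = toOrbit π x :=
  Quotient.sound (s := Equiv.Perm.SameCycle.setoid π)
    (Equiv.Perm.sameCycle_apply_left.mpr (Equiv.Perm.SameCycle.refl π x))

theorem orbitsMeeting_univ (π : Equiv.Perm Dart) :
    orbitsMeeting π Set.univ = Nat.card (Orbits π) := by
  rw [orbitsMeeting, Set.image_univ, Set.range_eq_univ.mpr Quotient.mk_surjective, Set.ncard_univ]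

/-- An equivalence relation on the darts that is compatible with `rot` and `rev` relates all
darts, as the surface is connected. -/
theorem rel_of_rot_of_rev {p : Dart → Dart → Prop} (hp : Equivalence p)
    (hrot : ∀ x, p x (M.rot x)) (hrev : ∀ x, p x (M.rev x)) (d e : Dart) : p d e := by
  induction M.connected d e with
  | rel x y h => rcases h with rfl | rfl; exacts [hrot _, hrev _]
  | refl x => exact hp.refl x
  | symm x y _ h => exact hp.symm h
  | trans x y z _ _ h1 h2 => exact hp.trans h1 h2

theorem rel_of_face_of_rev {p : Dart → Dart → Prop} (hp : Equivalence p)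
    (hface : ∀ x, p x (M.face x)) (hrev : ∀ x, p x (M.rev x)) (d e : Dart) : p d e := by
  refine M.rel_of_rot_of_rev hp (fun x => ?_) hrev d e
  have h := hface (M.rev (M.rot x))
  have h2 : M.face (M.rev (M.rot x)) = x := by simp [face, M.rev_rev]
  rw [h2] at h
  exact hp.symm (hp.trans (hrev _) h)

theorem eq_or_eq_rev_of_sameCycle {d e : Dart} (h : M.rev.SameCycle d e) :
    e = d ∨ e = M.rev d := by
  have hinv : M.rev⁻¹ = M.rev := by
    ext x
    rw [Equiv.Perm.inv_eq_iff_eq, M.rev_rev]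
  obtain ⟨n, rfl⟩ := h
  induction n with
  | zero => simp
  | succ n ih =>
    rw [add_comm, zpow_add, zpow_one, Equiv.Perm.mul_apply]
    rcases ih with ih | ih <;> rw [ih]
    exacts [Or.inr rfl, Or.inl (M.rev_rev d)]
  | pred n ih =>
    rw [sub_eq_add_neg, add_comm, zpow_add, zpow_neg_one, hinv, Equiv.Perm.mul_apply]
    rcases ih with ih | ih <;> rw [ih]
    exacts [Or.inr rfl, Or.inl (M.rev_rev d)]

variable [Fintype Dart]

theorem card_le_two_mul_card_orbits_rev : Fintype.card Dart ≤ 2 * Nat.card (Orbits M.rev) := by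
  classical
  have := Fintype.card_le_of_surjective
    (fun p : Orbits M.rev × Bool => if p.2 then M.rev p.1.out else p.1.out) (fun d => ?_)
  · rwa [Fintype.card_prod, Fintype.card_bool, mul_comm,
      ← Nat.card_eq_fintype_card (α := Orbits M.rev)] at this
  · have h : M.rev.SameCycle (toOrbit M.rev d).out d :=
      Quotient.mk_out (s := Equiv.Perm.SameCycle.setoid M.rev) d
    rcases M.eq_or_eq_rev_of_sameCycle h with h | h
    · exact ⟨(toOrbit M.rev d, false), by simpa using h.symm⟩
    · exact ⟨(toOrbit M.rev d, true), by simpa using h.symm⟩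

theorem bdry_mem_cycles {F : Dart → ℝ} (hF : F ∈ M.twoChains) : M.bdry F ∈ M.cycles := by
  classical
  refine ⟨fun d => by simp [bdry, M.rev_rev], fun d => ?_⟩
  have h : ∀ x, F (M.rev x) = F (M.rot.symm x) := fun x => by
    rw [← hF (M.rev x)]
    simp [face, M.rev_rev]
  simp only [bdry, LinearMap.coe_mk, AddHom.coe_mk, Finset.sum_sub_distrib, h]
  rw [sub_eq_zero]
  refine Finset.sum_equiv M.rot (fun x => ?_) (fun x _ => by simp)
  simp only [Finset.mem_filter, Finset.mem_univ, true_and]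
  exact Equiv.Perm.sameCycle_apply_right.symm

theorem boundaries_le_cycles : M.boundaries ≤ M.cycles := by
  rintro _ ⟨F, hF, rfl⟩
  exact M.bdry_mem_cycles hF

/-- The 2-chains have the faces as a basis, and by connectedness only the constant ones are
closed. -/
theorem finrank_boundaries_ge : Nat.card (Orbits M.face) ≤ finrank ℝ M.boundaries + 1 := by
  classical
  let T : (Orbits M.face → ℝ) →ₗ[ℝ] (Dart → ℝ) := M.bdry ∘ₗ LinearMap.funLeft ℝ ℝ (toOrbit M.face)
  have hT := LinearMap.finrank_range_add_finrank_ker T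
  have hrange : LinearMap.range T ≤ M.boundaries := by
    rintro _ ⟨G, rfl⟩
    refine ⟨LinearMap.funLeft ℝ ℝ (toOrbit M.face) G, fun d => ?_, rfl⟩
    rw [LinearMap.funLeft_apply, LinearMap.funLeft_apply, toOrbit_apply]
  have hker : LinearMap.ker T ≤ Submodule.span ℝ {fun _ => 1} := by
    intro G hG
    obtain ⟨d₀⟩ := M.nonempty
    refine Submodule.mem_span_singleton.mpr ⟨G (toOrbit M.face d₀), ?_⟩
    ext q
    obtain ⟨d, rfl⟩ := Quotient.mk_surjective q
    simp only [Pi.smul_apply, smul_eq_mul, mul_one]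
    refine M.rel_of_face_of_rev (p := fun d e => G (toOrbit M.face d) = G (toOrbit M.face e))
      ⟨fun _ => rfl, Eq.symm, Eq.trans⟩ (fun x => by rw [toOrbit_apply]) (fun x => ?_) d₀ d
    have := congrFun (LinearMap.mem_ker.mp hG) x
    exact sub_eq_zero.mp this
  have h1 := Submodule.finrank_mono hrange
  have h2 := (Submodule.finrank_mono hker).trans (finrank_span_le_card _)
  rw [Module.finrank_fintype_fun_eq_card, ← Nat.card_eq_fintype_card] at hT
  simp at h2
  omega

/-- The sums of a function on the darts over the orbits of a permutation. -/
noncomputable def orbitSum (π : Equiv.Perm Dart) : (Dart → ℝ) →ₗ[ℝ] (Orbits π → ℝ) :=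
  open Classical in
  { toFun a q := ∑ d with toOrbit π d = q, a d
    map_add' a b := by ext; simp [Finset.sum_add_distrib]
    map_smul' r a := by ext; simp [Finset.mul_sum] }

open Classical in
theorem orbitSum_single (π : Equiv.Perm Dart) (d : Dart) :
    orbitSum π (Pi.single d 1) = Pi.single (toOrbit π d) 1 := by
  ext q
  simp [orbitSum, Pi.single_apply, eq_comm]

/-- Outflow at the vertices together with the symmetrization over the edges has a cokernel of
dimension at most one, and vanishes on cycles. -/
theorem finrank_cycles_le :
    finrank ℝ M.cycles + Nat.card (Orbits M.rot) + Nat.card (Orbits M.rev) ≤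
      Fintype.card Dart + 1 := by
  classical
  let T : (Dart → ℝ) →ₗ[ℝ] (Orbits M.rot → ℝ) × (Orbits M.rev → ℝ) :=
    (orbitSum M.rot).prod (orbitSum M.rev)
  have hT := LinearMap.finrank_range_add_finrank_ker T
  have hker : M.cycles ≤ LinearMap.ker T := by
    rintro a ⟨ha, ha'⟩
    refine LinearMap.mem_ker.mpr (Prod.ext ?_ ?_)
    · ext q
      obtain ⟨d, rfl⟩ := Quotient.mk_surjective q
      refine Eq.trans (Finset.sum_congr (Finset.filter_congr fun x _ => ?_) fun _ _ => rfl) (ha' d)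
      exact Quotient.eq.trans ⟨Equiv.Perm.SameCycle.symm, Equiv.Perm.SameCycle.symm⟩
    · ext q
      have h : ∑ d with toOrbit M.rev d = q, a d = ∑ d with toOrbit M.rev d = q, a (M.rev d) := by
        refine (Finset.sum_equiv M.rev (fun x => ?_) fun _ _ => rfl).symm
        simp only [Finset.mem_filter, Finset.mem_univ, true_and, toOrbit_apply]
      simp only [ha, Finset.sum_neg_distrib] at h
      exact self_eq_neg.mp h
  obtain ⟨d₀⟩ := M.nonempty
  let v₀ : (Orbits M.rot → ℝ) × (Orbits M.rev → ℝ) := (Pi.single (toOrbit M.rot d₀) 1, 0)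
  have hW : LinearMap.range T ⊔ Submodule.span ℝ {v₀} = ⊤ := by
    set W := LinearMap.range T ⊔ Submodule.span ℝ {v₀}
    have hTW : ∀ d, ((Pi.single (toOrbit M.rot d) 1, Pi.single (toOrbit M.rev d) 1) :
        (Orbits M.rot → ℝ) × (Orbits M.rev → ℝ)) ∈ W := fun d => by
      refine Submodule.mem_sup_left ⟨Pi.single d 1, ?_⟩
      exact Prod.ext (orbitSum_single _ d) (orbitSum_single _ d)
    have hrot : ∀ d, ((Pi.single (toOrbit M.rot d) 1, 0) :
        (Orbits M.rot → ℝ) × (Orbits M.rev → ℝ)) ∈ W := fun d => by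
      refine (M.rel_of_rot_of_rev (p := fun d e => ((Pi.single (toOrbit M.rot d) 1, 0) :
        (Orbits M.rot → ℝ) × (Orbits M.rev → ℝ)) ∈ W ↔ ((Pi.single (toOrbit M.rot e) 1, 0) :
        (Orbits M.rot → ℝ) × (Orbits M.rev → ℝ)) ∈ W) ⟨fun _ => Iff.rfl, Iff.symm, Iff.trans⟩
        (fun x => by rw [toOrbit_apply]) (fun x => ?_) d₀ d).mp
        (Submodule.mem_sup_right (Submodule.mem_span_singleton_self _))
      have h : ((Pi.single (toOrbit M.rot x) 1, 0) :
          (Orbits M.rot → ℝ) × (Orbits M.rev → ℝ)) -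
            (Pi.single (toOrbit M.rot (M.rev x)) 1, 0) ∈ W := by
        have := W.sub_mem (hTW x) (hTW (M.rev x))
        rwa [toOrbit_apply M.rev, Prod.mk_sub_mk, sub_self, ← sub_self 0, ← Prod.mk_sub_mk] at this
      exact ⟨fun hx => by simpa using W.sub_mem hx h, fun hx => by simpa using W.add_mem h hx⟩
    rw [eq_top_iff, ← ((Pi.basisFun ℝ (Orbits M.rot)).prod (Pi.basisFun ℝ (Orbits M.rev))).span_eq,
      Submodule.span_le]
    rintro _ ⟨q | q, rfl⟩
    · obtain ⟨d, rfl⟩ := Quotient.mk_surjective q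
      simpa using hrot d
    · obtain ⟨d, rfl⟩ := Quotient.mk_surjective q
      simpa using W.sub_mem (hTW d) (hrot d)
  have h1 := Submodule.finrank_mono hker
  have h2 := Submodule.finrank_add_le_finrank_add_finrank (LinearMap.range T)
    (Submodule.span ℝ {v₀})
  rw [hW, finrank_top, Module.finrank_prod, Module.finrank_fintype_fun_eq_card,
    Module.finrank_fintype_fun_eq_card, ← Nat.card_eq_fintype_card, ← Nat.card_eq_fintype_card] at h2
  have h3 := finrank_span_le_card (R := ℝ) {v₀}
  rw [Module.finrank_fintype_fun_eq_card] at hT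
  simp only [Set.toFinset_singleton, Finset.card_singleton] at h3
  omega

theorem finrank_H1_le : (finrank ℝ M.H1 : ℤ) ≤ 2 - M.eulerChar Set.univ := by
  have h1 := Submodule.finrank_quotient_add_finrank (M.boundaries.submoduleOf M.cycles)
  rw [(Submodule.submoduleOfEquivOfLe M.boundaries_le_cycles).finrank_eq] at h1
  have h2 := M.finrank_boundaries_ge
  have h3 := M.finrank_cycles_le
  have h4 := M.card_le_two_mul_card_orbits_rev
  simp only [eulerChar, orbitsMeeting_univ]
  change finrank ℝ M.H1 + _ = _ at h1
  omega

end Betti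

/-! ### Circles and their classes -/

namespace OrientedCircle

variable {Dart : Type*} {M : CellSurface Dart}

theorem exists_sameVertex_of_onEdge (c : M.OrientedCircle) {d : Dart} (h : c.OnEdge d) :
    ∃ i, M.SameVertex (c.dart i) d := by
  obtain ⟨i, rfl | rfl⟩ := h
  · exact ⟨i, Equiv.Perm.SameCycle.refl _ _⟩
  · exact ⟨i + 1, (c.next i).symm⟩

variable [DecidableEq Dart]

theorem chain_apply (c : M.OrientedCircle) (d : Dart) :
    c.chain d = ∑ i, ((if d = c.dart i then 1 else 0) - if d = M.rev (c.dart i) then 1 else 0) := by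
  simp [chain, Pi.single_apply]

theorem chain_eq_zero_of_not_onEdge (c : M.OrientedCircle) {d : Dart} (h : ¬ c.OnEdge d) :
    c.chain d = 0 := by
  rw [chain_apply]
  refine Finset.sum_eq_zero fun i _ => ?_
  rw [if_neg fun hd => h ⟨i, Or.inl hd.symm⟩, if_neg fun hd => h ⟨i, Or.inr hd.symm⟩, sub_zero]

theorem chain_dart (c : M.OrientedCircle) (i : ZMod c.length) : c.chain (c.dart i) = 1 := by
  rw [chain_apply, Finset.sum_eq_single i]
  · rw [if_pos rfl, if_neg (c.no_backtrack i i), sub_zero]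
  · intro j _ hj
    rw [if_neg, if_neg (c.no_backtrack i j), sub_zero]
    intro h
    exact hj (c.embedded j i (h ▸ Equiv.Perm.SameCycle.refl _ _))
  · simp

theorem chain_eq_zero_of_disjoint {c c' : M.OrientedCircle} (h : c.Disjoint c') {d : Dart}
    {i : ZMod c.length} (hd : M.SameVertex (c.dart i) d) : c'.chain d = 0 := by
  refine c'.chain_eq_zero_of_not_onEdge fun hd' => ?_
  obtain ⟨j, hj⟩ := c'.exists_sameVertex_of_onEdge hd'
  exact h i j (hd.trans hj.symm)

theorem chain_reverse (c : M.OrientedCircle) : c.reverse.chain = - c.chain := by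
  ext d
  rw [Pi.neg_apply, chain_apply, chain_apply, ← Finset.sum_neg_distrib]
  refine Fintype.sum_equiv (Equiv.neg (ZMod c.length)) _ _ fun i => ?_
  simp only [reverse, M.rev_rev, Equiv.neg_apply, neg_sub]
  rfl

variable [Fintype Dart]

theorem homologyClass_reverse (c : M.OrientedCircle) :
    c.reverse.homologyClass = - c.homologyClass := by
  rw [homologyClass, homologyClass, ← Submodule.Quotient.mk_neg]
  congr 1
  exact Subtype.ext c.chain_reverse

theorem intersectionForm_eq_zero_of_disjoint {c c' : M.OrientedCircle} (h : c.Disjoint c') :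
    M.intersectionForm c.homologyClass c'.homologyClass = 0 := by
  rw [homologyClass, homologyClass, intersectionForm_mk, chainPairing_apply, neg_eq_zero]
  refine Finset.sum_eq_zero fun d _ => ?_
  by_cases hd : c.OnEdge d
  · obtain ⟨i, hi⟩ := c.exists_sameVertex_of_onEdge hd
    have hpot : ∀ e, M.SameVertex (c.dart i) e → M.potential c'.chain e = 0 := fun e he => by
      simp only [potential, LinearMap.coe_mk, AddHom.coe_mk]
      rw [Finset.sum_eq_zero, zero_div]
      intro m _
      rw [chain_eq_zero_of_disjoint h (he.trans ⟨m, by simp⟩), mul_zero]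
    simp only [hpot d hi, hpot (M.rot d) (hi.trans (Equiv.Perm.sameCycle_apply_right.mpr
      (Equiv.Perm.SameCycle.refl _ _))), add_zero, zero_div, mul_zero]
  · simp only [c.chain_eq_zero_of_not_onEdge hd, zero_mul]

theorem sum_smul_homologyClass {ι : Type*} [Fintype ι] (c : ι → M.OrientedCircle) (r : ι → ℝ) :
    ∑ i, r i • (c i).homologyClass = Submodule.Quotient.mk
      (∑ i, r i • (⟨(c i).chain, (c i).chain_mem_cycles⟩ : M.cycles)) := by
  simp only [homologyClass, ← Submodule.mkQ_apply, map_sum, map_smul]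

end OrientedCircle

/-! ### Minimal handlebody diagrams define Lagrangian subspaces -/

namespace HandlebodyDiagram

variable {Dart : Type*} {M : CellSurface Dart} {ι : Type*} [Fintype ι] (H : M.HandlebodyDiagram ι)

/-- The complement of a minimal diagram is connected. -/
theorem IsMinimal.rel {H : M.HandlebodyDiagram ι} (hH : H.IsMinimal) (d e : Dart) :
    M.componentSetoid H.circle d e := by
  refine M.rel_of_face_of_rev (p := M.componentSetoid H.circle) (M.componentSetoid H.circle).iseqv
    (fun x => .rel _ _ (Or.inl rfl)) (fun x => ?_) d e
  by_cases hx : ∃ i, (H.circle i).OnEdge x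
  · obtain ⟨i, j, rfl | rfl⟩ := hx
    · exact hH i j
    · rw [M.rev_rev]
      exact (M.componentSetoid H.circle).symm (hH i j)
  · exact .rel _ _ (Or.inr ⟨rfl, not_exists.mp hx⟩)

theorem IsMinimal.eulerChar_eq {H : M.HandlebodyDiagram ι} (hH : H.IsMinimal) :
    M.eulerChar Set.univ = 2 - 2 * Fintype.card ι := by
  obtain ⟨d⟩ := M.nonempty
  have h : Nat.card (Quotient (M.componentSetoid H.circle)) = 1 := by
    refine Nat.card_eq_one_iff_unique.mpr ⟨⟨fun x y => ?_⟩, ⟨Quotient.mk _ d⟩⟩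
    induction x using Quotient.inductionOn
    induction y using Quotient.inductionOn
    exact Quotient.sound (hH.rel _ _)
  have := H.planar
  rw [h] at this
  omega

variable [Fintype Dart] [DecidableEq Dart]

theorem lagrangian_eq_span :
    H.lagrangian = Submodule.span ℝ (Set.range fun i => (H.circle i).homologyClass) := by
  refine le_antisymm (fun x hx => ?_) (Submodule.span_le.mpr ?_)
  · obtain ⟨⟨a, ha⟩, rfl⟩ := Submodule.Quotient.mk_surjective _ x
    have hx' : a ∈ H.handlebodyBoundaries :=
      (Submodule.Quotient.mk_eq_zero (H.handlebodyBoundaries.submoduleOf M.cycles)).mp hx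
    obtain ⟨b, hb, c, hc, rfl⟩ := Submodule.mem_sup.mp hx'
    obtain ⟨r, rfl⟩ := (Submodule.mem_span_range_iff_exists_fun ℝ).mp hc
    refine (Submodule.mem_span_range_iff_exists_fun ℝ).mpr ⟨r, ?_⟩
    rw [OrientedCircle.sum_smul_homologyClass, eq_comm, mk_eq_mk_iff]
    simpa using hb
  · rintro _ ⟨i, rfl⟩
    exact H.homologyClass_mem_lagrangian i

/-- A 2-chain whose boundary is a combination of the circles of a minimal diagram is constant, as
it does not change across edges off the circles; so that combination is trivial. -/
theorem IsMinimal.linearIndependent_homologyClass {H : M.HandlebodyDiagram ι} (hH : H.IsMinimal) :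
    LinearIndependent ℝ fun i => (H.circle i).homologyClass := by
  classical
  rw [Fintype.linearIndependent_iff]
  intro r hr
  have hb : ∑ i, r i • (H.circle i).chain ∈ M.boundaries := by
    rw [OrientedCircle.sum_smul_homologyClass, Submodule.Quotient.mk_eq_zero] at hr
    have hr' : ((∑ i, r i • (⟨(H.circle i).chain, (H.circle i).chain_mem_cycles⟩ : M.cycles) :
      M.cycles) : Dart → ℝ) ∈ M.boundaries := hr
    simpa using hr'
  obtain ⟨F, hF, hFr⟩ := hb
  have hconst : ∀ d e, F d = F e := fun d e => by
    have h := hH.rel d e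
    induction h with
    | rel x y h =>
      rcases h with rfl | ⟨rfl, h⟩
      · exact (hF x).symm
      · have := congrFun hFr x
        rw [Finset.sum_apply, Finset.sum_eq_zero fun i _ => ?_] at this
        · exact sub_eq_zero.mp this
        · rw [Pi.smul_apply, (H.circle i).chain_eq_zero_of_not_onEdge (h i), smul_zero]
    | refl x => rfl
    | symm x y _ h => exact h.symm
    | trans x y z _ _ h1 h2 => exact h1.trans h2
  intro i
  have h := congrFun hFr ((H.circle i).dart 0)
  rw [Finset.sum_apply, Finset.sum_eq_single i] at h
  · rw [Pi.smul_apply, (H.circle i).chain_dart, smul_eq_mul, mul_one] at h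
    rw [← h]
    exact sub_eq_zero.mpr (hconst _ _)
  · intro j _ hj
    rw [Pi.smul_apply, OrientedCircle.chain_eq_zero_of_disjoint (H.disjoint i j hj.symm)
      (Equiv.Perm.SameCycle.refl _ _), smul_zero]
  · simp

theorem intersectionForm_homologyClass (i j : ι) :
    M.intersectionForm (H.circle i).homologyClass (H.circle j).homologyClass = 0 := by
  by_cases h : i = j
  · rw [h]
    exact M.intersectionForm_isAlt _
  · exact OrientedCircle.intersectionForm_eq_zero_of_disjoint (H.disjoint i j h)

theorem intersectionForm_lagrangian {x y : M.H1} (hx : x ∈ H.lagrangian) (hy : y ∈ H.lagrangian) :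
    M.intersectionForm x y = 0 := by
  rw [lagrangian_eq_span] at hx hy
  induction hx, hy using Submodule.span_induction₂ with
  | mem_mem x y hx hy =>
    obtain ⟨i, rfl⟩ := hx
    obtain ⟨j, rfl⟩ := hy
    exact H.intersectionForm_homologyClass i j
  | zero_left => simp
  | zero_right => simp
  | add_left x y z _ _ _ h1 h2 => simp [h1, h2]
  | add_right x y z _ _ _ h1 h2 => simp [h1, h2]
  | smul_left r x y _ _ h => simp [h]
  | smul_right r x y _ _ h => simp [h]

theorem IsMinimal.finrank_lagrangian {H : M.HandlebodyDiagram ι} (hH : H.IsMinimal) :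
    finrank ℝ H.lagrangian = Fintype.card ι := by
  rw [lagrangian_eq_span]
  exact finrank_span_eq_card hH.linearIndependent_homologyClass

theorem le_orthogonal_lagrangian :
    H.lagrangian ≤ M.intersectionForm.orthogonal H.lagrangian :=
  fun _ hx _ hy => H.intersectionForm_lagrangian hy hx

/-- Both inequalities between `finrank H₁` and twice the number of circles are needed: a bound from
the Euler characteristic, and one from the dimension of an isotropic subspace. -/
theorem IsMinimal.finrank_H1 {H : M.HandlebodyDiagram ι} (hH : H.IsMinimal) :
    finrank ℝ M.H1 = Fintype.card ι * 2 := by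
  have h1 := M.finrank_H1_le
  rw [hH.eulerChar_eq] at h1
  have h2 := Submodule.finrank_mono H.le_orthogonal_lagrangian
  rw [LinearMap.BilinForm.finrank_orthogonal M.intersectionForm_nondegenerate,
    hH.finrank_lagrangian] at h2
  have h3 := Submodule.finrank_le H.lagrangian
  rw [hH.finrank_lagrangian] at h3
  omega

theorem IsMinimal.orthogonal_lagrangian {H : M.HandlebodyDiagram ι} (hH : H.IsMinimal) :
    M.intersectionForm.orthogonal H.lagrangian = H.lagrangian := by
  refine (Submodule.eq_of_le_of_finrank_eq H.le_orthogonal_lagrangian ?_).symm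
  rw [LinearMap.BilinForm.finrank_orthogonal M.intersectionForm_nondegenerate,
    hH.finrank_lagrangian, hH.finrank_H1]
  omega

end HandlebodyDiagram

end CellSurface

/-! ### Sign-orderings -/

section SignOrderings

variable {X : Type*} [Fintype X]

theorem CompleteOrdering.exists_smul_eq (e e' : CompleteOrdering X) :
    ∃ π : Equiv.Perm X, π • e = e' :=
  ⟨Equiv.trans (Equiv.symm e) e', Equiv.ext fun n =>
    congrArg (Equiv.toFun e') (Equiv.symm_apply_apply e n)⟩

theorem CompleteOrdering.smul_left_injective (e : CompleteOrdering X) :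
    Function.Injective fun π : Equiv.Perm X => π • e := fun π σ h => by
  ext x
  obtain ⟨n, rfl⟩ := Equiv.surjective e x
  exact congrArg (fun f : CompleteOrdering X => Equiv.toFun f n) h

variable [DecidableEq X]

theorem CompleteOrdering.signOrdering_smul_eq_iff (e : CompleteOrdering X) (π : Equiv.Perm X) :
    (π • e).signOrdering = e.signOrdering ↔ Equiv.Perm.sign π = 1 := by
  refine Quotient.eq.trans ?_
  constructor
  · rintro ⟨⟨σ, hσ⟩, h⟩
    rw [← e.smul_left_injective h]
    exact hσ
  · intro h
    exact ⟨⟨π, h⟩, rfl⟩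

variable {B : Type*} [AddCommGroup B] [Module ℝ B]

theorem orientationSign_smul (o : VOrientation B) (w : X → B) (e : CompleteOrdering X)
    (π : Equiv.Perm X) :
    orientationSign o (fun n => w (Equiv.toFun (π • e) n)) =
      SignType.sign (Equiv.Perm.sign π : ℤ) * orientationSign o (fun n => w (Equiv.toFun e n)) := by
  by_cases h : finrank ℝ B = Fintype.card X
  swap
  · rw [orientationSign_of_finrank_ne o h, orientationSign_of_finrank_ne o h, mul_zero]
  obtain ⟨f, -, hf⟩ := exists_alternatingMap_orientationSign o h
  let e' : Fin (Fintype.card X) ≃ X := e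
  have he : (fun n => w (Equiv.toFun (π • e) n)) =
      (fun n => w (Equiv.toFun e n)) ∘ (e'.symm.permCongr π) := by
    ext1 n
    change w (π (e' n)) = w (e' (e'.symm (π (e' n))))
    rw [e'.apply_symm_apply]
  rw [he, hf, f.map_perm, Equiv.Perm.sign_permCongr, hf]
  rcases Int.units_eq_one_or (Equiv.Perm.sign π) with h | h <;> simp [h, Left.sign_neg]

/-- A basis indexed by `X` is positively oriented in exactly the orderings of one sign-ordering,
provided it is so in some ordering. -/
theorem signOrdering_eq_iff_orientationSign_eq_one (o : VOrientation B) (w : X → B)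
    {e₀ : CompleteOrdering X}
    (h₀ : orientationSign o (fun n => w (Equiv.toFun e₀ n)) = 1) (e : CompleteOrdering X) :
    e.signOrdering = e₀.signOrdering ↔ orientationSign o (fun n => w (Equiv.toFun e n)) = 1 := by
  obtain ⟨π, rfl⟩ := e₀.exists_smul_eq e
  rw [orientationSign_smul, h₀, mul_one, CompleteOrdering.signOrdering_smul_eq_iff]
  rcases Int.units_eq_one_or (Equiv.Perm.sign π) with h | h <;> simp [h]

/-- An elementary operation on the vectors multiplies the sign by that of its diagonal entry. -/
theorem orientationSign_update (o : VOrientation B) (w : X → B) (e : CompleteOrdering X)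
    {x k : X} {s t : ℝ} (hk : x ≠ k ∨ t = 0) :
    orientationSign o (fun n => Function.update w x (s • w x + t • w k) (Equiv.toFun e n)) =
      SignType.sign s * orientationSign o (fun n => w (Equiv.toFun e n)) := by
  by_cases h : finrank ℝ B = Fintype.card X
  swap
  · rw [orientationSign_of_finrank_ne o h, orientationSign_of_finrank_ne o h, mul_zero]
  obtain ⟨f, -, hf⟩ := exists_alternatingMap_orientationSign o h
  let e' : Fin (Fintype.card X) ≃ X := e
  let v : Fin (Fintype.card X) → B := fun n => w (e' n)
  have hv : ∀ y, w y = v (e'.symm y) := fun y => by simp [v]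
  have he : (fun n => Function.update w x (s • w x + t • w k) (Equiv.toFun e n)) =
      Function.update v (e'.symm x) (s • v (e'.symm x) + t • v (e'.symm k)) := by
    rw [← hv, ← hv]
    exact Function.update_comp_equiv w e' x _
  rw [he, hf, hf, f.map_update_add, f.map_update_smul, f.map_update_smul, Function.update_eq_self]
  have h0 : t • f (Function.update v (e'.symm x) (v (e'.symm k))) = 0 := by
    rcases hk with hk | rfl
    · rw [f.map_update_self v (e'.symm.injective.ne hk), smul_zero]
    · rw [zero_smul]
  rw [h0, add_zero, smul_eq_mul, sign_mul]
  rfl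

end SignOrderings

/-! ### The exact sequence of a minimal Heegaard diagram -/

namespace CellSurface

variable {Dart ι κ : Type*} [Fintype Dart] [DecidableEq Dart] [Fintype ι] [Fintype κ]
  {M : CellSurface Dart}

theorem HandlebodyDiagram.IsMinimal.exists_basis {H : M.HandlebodyDiagram ι} (hH : H.IsMinimal) :
    ∃ b : Basis ι ℝ H.lagrangian, ⇑b = H.circleClass := by
  have li : LinearIndependent ℝ H.circleClass :=
    LinearIndependent.of_comp H.lagrangian.subtype hH.linearIndependent_homologyClass
  have sp : Submodule.span ℝ (Set.range H.circleClass) = ⊤ :=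
    li.span_eq_top_of_card_eq_finrank' hH.finrank_lagrangian.symm
  exact ⟨Basis.mk li sp.ge, Basis.coe_mk li sp.ge⟩

namespace HeegaardDiagram

variable {D : M.HeegaardDiagram ι κ}

theorem IsMinimal.exists_basis (hD : D.IsMinimal) :
    ∃ b : Basis (ι ⊕ κ) ℝ D.directSum, ⇑b = D.circleVector := by
  obtain ⟨b, hb⟩ := hD.1.exists_basis
  obtain ⟨b', hb'⟩ := hD.2.exists_basis
  refine ⟨b.prod b', funext fun x => ?_⟩
  rcases x with i | j
  · exact Prod.ext (by simp [circleVector, hb]) (by simp [circleVector])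
  · exact Prod.ext (by simp [circleVector]) (by simp [circleVector, hb'])

theorem interToSum_injective : Function.Injective D.interToSum := fun _ _ h =>
  Submodule.inclusion_injective _ (congrArg Prod.fst h)

theorem exact_interToSum_sumToH1 : Function.Exact D.interToSum D.sumToH1 := by
  rintro ⟨⟨x, hx⟩, ⟨y, hy⟩⟩
  constructor
  · intro h
    have hxy : x + y = 0 := h
    obtain rfl : y = -x := (neg_eq_of_add_eq_zero_right hxy).symm
    exact ⟨⟨x, hx, by simpa using hy⟩, rfl⟩
  · rintro ⟨z, hz⟩
    rw [← hz]
    exact add_neg_cancel (z : M.H1)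

theorem range_sumToH1 : LinearMap.range D.sumToH1 = D.lower.lagrangian ⊔ D.upper.lagrangian := by
  rw [sumToH1, LinearMap.range_coprod, Submodule.range_subtype, Submodule.range_subtype]

theorem IsMinimal.orthogonal_inter (hD : D.IsMinimal) :
    M.intersectionForm.orthogonal D.inter = D.lower.lagrangian ⊔ D.upper.lagrangian := by
  have h : M.intersectionForm.orthogonal (D.lower.lagrangian ⊔ D.upper.lagrangian) = D.inter := by
    rw [inter]
    nth_rewrite 2 [← hD.1.orthogonal_lagrangian, ← hD.2.orthogonal_lagrangian]
    refine le_antisymm (le_inf ?_ ?_) ?_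
    · exact LinearMap.BilinForm.orthogonal_le le_sup_left
    · exact LinearMap.BilinForm.orthogonal_le le_sup_right
    · rintro x ⟨hx, hx'⟩ y hy
      obtain ⟨a, ha, b, hb, rfl⟩ := Submodule.mem_sup.mp hy
      have h1 : M.intersectionForm a x = 0 := hx a ha
      have h2 : M.intersectionForm b x = 0 := hx' b hb
      change M.intersectionForm (a + b) x = 0
      rw [map_add, LinearMap.add_apply, h1, h2, add_zero]
  rw [← h, LinearMap.BilinForm.orthogonal_orthogonal M.intersectionForm_nondegenerate
    M.intersectionForm_isAlt.isRefl]

theorem IsMinimal.exact_sumToH1_h1ToDual (hD : D.IsMinimal) :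
    Function.Exact D.sumToH1 D.h1ToDual := by
  rw [LinearMap.exact_iff, range_sumToH1, ← hD.orthogonal_inter]
  ext x
  refine ⟨fun h z hz => ?_, fun h => LinearMap.ext fun z => ?_⟩
  · have h1 : M.intersectionForm x z = 0 := LinearMap.congr_fun h (⟨z, hz⟩ : D.inter)
    exact M.intersectionForm_isAlt.isRefl _ _ h1
  · exact M.intersectionForm_isAlt.isRefl _ _ (h z z.2)

theorem h1ToDual_surjective : Function.Surjective D.h1ToDual := fun φ => by
  obtain ⟨ψ, hψ⟩ := LinearMap.exists_extend φ
  refine ⟨(M.intersectionForm.toDual M.intersectionForm_nondegenerate).symm ψ, ?_⟩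
  refine LinearMap.ext fun z => ?_
  rw [← hψ]
  exact M.intersectionForm.apply_toDual_symm_apply (hB := M.intersectionForm_nondegenerate) ψ z

theorem IsMinimal.existsUnique_isCassonOrientation (hD : D.IsMinimal) :
    ∃! o : VOrientation D.directSum, D.IsCassonOrientation o := by
  let ε := (Fintype.equivFin ι).symm
  obtain ⟨oH, hoH⟩ := exists_isSymplecticOrientation M.intersectionForm M.intersectionForm_isAlt
    M.intersectionForm_nondegenerate hD.1.finrank_H1
    (hD.1.linearIndependent_homologyClass.comp ε ε.injective)
    (fun i j => D.lower.intersectionForm_homologyClass (ε i) (ε j))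
  exact existsUnique_isSymplecticallyInduced interToSum_injective exact_interToSum_sumToH1
    hD.exact_sumToH1_h1ToDual h1ToDual_surjective hoH

/-- An isomorphism of the homology groups that preserves the intersection forms and the two
Lagrangian subspaces transports the orientation of `L_l ⊕ L_u`. -/
theorem IsCassonOrientation.exists_comp {Dart' : Type*} [Fintype Dart'] [DecidableEq Dart']
    {M' : CellSurface Dart'} {D' : M'.HeegaardDiagram ι κ} (Φ : M.H1 ≃ₗ[ℝ] M'.H1)
    (hΦ : ∀ x y, M'.intersectionForm (Φ x) (Φ y) = M.intersectionForm x y)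
    (hl : D.lower.lagrangian.map Φ.toLinearMap = D'.lower.lagrangian)
    (hu : D.upper.lagrangian.map Φ.toLinearMap = D'.upper.lagrangian)
    {o : VOrientation D.directSum} (ho : D.IsCassonOrientation o) :
    ∃ (Ψ : D.directSum ≃ₗ[ℝ] D'.directSum) (o' : VOrientation D'.directSum),
      (∀ z, ((Ψ z).1 : M'.H1) = Φ z.1 ∧ ((Ψ z).2 : M'.H1) = Φ z.2) ∧ D'.IsCassonOrientation o' ∧
      ∀ (n : ℕ) (v : Fin n → D.directSum),
        orientationSign o' (fun j => Ψ (v j)) = orientationSign o v := by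
  have hi : D.inter.map Φ.toLinearMap = D'.inter := by
    rw [inter, Submodule.map_inf _ Φ.injective, hl, hu]
  let Ψ : D.directSum ≃ₗ[ℝ] D'.directSum :=
    (Φ.ofSubmodules _ _ hl).prodCongr (Φ.ofSubmodules _ _ hu)
  obtain ⟨o', ho', h⟩ := IsSymplecticallyInduced.exists_comp (ω' := M'.intersectionForm)
    (i' := D'.interToSum) (f' := D'.sumToH1) (p' := D'.h1ToDual) (Φ.ofSubmodules _ _ hi) Ψ Φ
    (fun z => Prod.ext (Subtype.ext rfl) (Subtype.ext (by exact map_neg Φ (z : M.H1))))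
    (fun z => map_add Φ _ _) (fun x z => hΦ _ _) hΦ ho
  exact ⟨Ψ, o', fun z => ⟨rfl, rfl⟩, ho', h⟩

/-! ### Canonical sign-orderings -/

theorem IsMinimal.card_eq (hD : D.IsMinimal) : Fintype.card ι = Fintype.card κ := by
  have h := hD.1.finrank_H1
  rw [hD.2.finrank_H1] at h
  omega

theorem IsMinimal.orientationSign_ne_zero (hD : D.IsMinimal) (o : VOrientation D.directSum)
    (e : CompleteOrdering (ι ⊕ κ)) :
    orientationSign o (fun n => D.circleVector (Equiv.toFun e n)) ≠ 0 := by
  obtain ⟨b, hb⟩ := hD.exists_basis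
  let e' : Fin (Fintype.card (ι ⊕ κ)) ≃ ι ⊕ κ := e
  have h := orientationSign_basis_ne_zero o (b.reindex e'.symm)
  rw [Basis.coe_reindex, hb] at h
  exact h

variable [DecidableEq ι] [DecidableEq κ]

/-- If there are circles, there are at least two of them, a lower and an upper one. -/
theorem IsMinimal.exists_sign_eq_neg_one (hD : D.IsMinimal) [h : Nonempty (ι ⊕ κ)] :
    ∃ π : Equiv.Perm (ι ⊕ κ), Equiv.Perm.sign π = -1 := by
  have hcard := hD.card_eq
  rw [← Fintype.card_pos_iff, Fintype.card_sum] at h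
  obtain ⟨i⟩ := Fintype.card_pos_iff.mp (show 0 < Fintype.card ι by omega)
  obtain ⟨j⟩ := Fintype.card_pos_iff.mp (show 0 < Fintype.card κ by omega)
  exact ⟨Equiv.swap (Sum.inl i) (Sum.inr j), Equiv.Perm.sign_swap Sum.inl_ne_inr⟩

/-- In the presence of circles this holds as an odd permutation changes the sign of an ordering;
otherwise the sign of the empty ordering is positive. -/
theorem IsMinimal.exists_orientationSign_eq_one (hD : D.IsMinimal) {o : VOrientation D.directSum}
    (ho : D.IsCassonOrientation o) :
    ∃ e : CompleteOrdering (ι ⊕ κ),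
      orientationSign o (fun n => D.circleVector (Equiv.toFun e n)) = 1 := by
  let e : CompleteOrdering (ι ⊕ κ) := (Fintype.equivFin (ι ⊕ κ)).symm
  rcases isEmpty_or_nonempty (ι ⊕ κ) with hι | hι
  · have h0 : Fintype.card (ι ⊕ κ) = 0 := Fintype.card_eq_zero
    have hι0 : Fintype.card ι = 0 := by
      rw [Fintype.card_sum] at h0
      omega
    refine ⟨e, IsSymplecticallyInduced.orientationSign_eq_one ho ?_ ?_ h0 _⟩
    · have := Submodule.finrank_le D.inter
      rw [hD.1.finrank_H1] at this
      omega
    · rw [hD.1.finrank_H1, hι0]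
  · obtain ⟨π, hπ⟩ := hD.exists_sign_eq_neg_one
    have h0 := hD.orientationSign_ne_zero o e
    have h1 := orientationSign_smul o D.circleVector e π
    rw [hπ] at h1
    by_cases h : orientationSign o (fun n => D.circleVector (Equiv.toFun e n)) = 1
    · exact ⟨e, h⟩
    · refine ⟨_, h1.trans ?_⟩
      revert h0 h
      generalize orientationSign o (fun n => D.circleVector (Equiv.toFun e n)) = s
      cases s <;> simp

theorem IsMinimal.existsUnique_isCanonicalSignOrdering (hD : D.IsMinimal) :
    ∃! s : SignOrdering (ι ⊕ κ), D.IsCanonicalSignOrdering s := by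
  obtain ⟨o, ho, hu⟩ := hD.existsUnique_isCassonOrientation
  obtain ⟨e₀, h₀⟩ := hD.exists_orientationSign_eq_one ho
  refine ⟨e₀.signOrdering, ⟨o, ho, signOrdering_eq_iff_orientationSign_eq_one o _ h₀⟩, ?_⟩
  rintro s ⟨o', ho', hs⟩
  rw [hu o' ho'] at hs
  exact ((hs e₀).mpr h₀).symm

end HeegaardDiagram

/-! ### Circle slides and reversals -/

namespace HandlebodyDiagram

variable {H H' : M.HandlebodyDiagram ι}

/-- In homology, both circle slides and reversals replace the class `[c i]` of one circle by
`s [c i] + t [c k]`. -/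
theorem lagrangian_eq_of_homologyClass_eq {i k : ι} {s t : ℝ} (hs : s ≠ 0) (hk : i ≠ k ∨ t = 0)
    (hi : (H'.circle i).homologyClass =
      s • (H.circle i).homologyClass + t • (H.circle k).homologyClass)
    (hj : ∀ j, j ≠ i → (H'.circle j).homologyClass = (H.circle j).homologyClass) :
    H'.lagrangian = H.lagrangian := by
  rw [lagrangian_eq_span, lagrangian_eq_span]
  have mem : ∀ j, (H.circle j).homologyClass ∈
      Submodule.span ℝ (Set.range fun i => (H.circle i).homologyClass) :=
    fun j => Submodule.subset_span ⟨j, rfl⟩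
  have mem' : ∀ j, (H'.circle j).homologyClass ∈
      Submodule.span ℝ (Set.range fun i => (H'.circle i).homologyClass) :=
    fun j => Submodule.subset_span ⟨j, rfl⟩
  refine le_antisymm (Submodule.span_le.mpr ?_) (Submodule.span_le.mpr ?_)
  · rintro _ ⟨j, rfl⟩
    change (H'.circle j).homologyClass ∈ _
    by_cases h : j = i
    · rw [h, hi]
      exact add_mem (Submodule.smul_mem _ _ (mem i)) (Submodule.smul_mem _ _ (mem k))
    · rw [hj j h]
      exact mem j
  · rintro _ ⟨j, rfl⟩
    change (H.circle j).homologyClass ∈ _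
    by_cases h : j = i
    · have hk' : t • (H.circle k).homologyClass = t • (H'.circle k).homologyClass := by
        rcases hk with hk | rfl
        · rw [hj k hk.symm]
        · rw [zero_smul, zero_smul]
      rw [h, eq_inv_smul_iff₀ hs |>.mpr (eq_sub_of_add_eq hi.symm), hk']
      exact Submodule.smul_mem _ _ (sub_mem (mem' i) (Submodule.smul_mem _ _ (mem' k)))
    · rw [← hj j h]
      exact mem' j

theorem IsReversal.homologyClass_eq (h : H.IsReversal H') :
    ∃ i, (H.circle i).homologyClass =
        (-1 : ℝ) • (H'.circle i).homologyClass + (0 : ℝ) • (H'.circle i).homologyClass ∧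
      ∀ j, j ≠ i → (H.circle j).homologyClass = (H'.circle j).homologyClass := by
  obtain ⟨i, hi, hj⟩ := h
  refine ⟨i, ?_, fun j h => by rw [hj j h]⟩
  rw [hi, OrientedCircle.homologyClass_reverse, neg_one_smul, neg_neg, zero_smul, add_zero]

/-- The boundary of the pair of pants is a relation between the three classes. -/
theorem IsSlide.homologyClass_eq (h : H.IsSlide H') :
    ∃ i k, ∃ t : ℝ, i ≠ k ∧ (H'.circle i).homologyClass =
        (1 : ℝ) • (H.circle i).homologyClass + t • (H.circle k).homologyClass ∧
      ∀ j, j ≠ i → (H'.circle j).homologyClass = (H.circle j).homologyClass := by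
  obtain ⟨i, k, hik, hj, P, η, ε, hP, -⟩ := h
  refine ⟨i, k, -(((η * ε : ℤˣ) : ℤ) : ℝ), hik, ?_, fun j h => by rw [hj j h]⟩
  have hb : M.regionBoundary P ∈ M.boundaries := by
    refine ⟨P.indicator 1, fun d => ?_, rfl⟩
    by_cases hd : d ∈ P
    · rw [Set.indicator_of_mem hd, Set.indicator_of_mem ((hP.union_of_faces d).mp hd)]
      rfl
    · rw [Set.indicator_of_notMem hd,
        Set.indicator_of_notMem (fun h => hd ((hP.union_of_faces d).mpr h))]
  have hη : ((η : ℤ) : ℝ) * ((η : ℤ) : ℝ) = 1 := by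
    rw [← Int.cast_mul, ← Units.val_mul, Int.units_mul_self, Units.val_one, Int.cast_one]
  have hb' := M.boundaries.smul_mem ((η : ℤ) : ℝ) hb
  have hcls : (1 : ℝ) • (H.circle i).homologyClass +
      (-(((η * ε : ℤˣ) : ℤ) : ℝ)) • (H.circle k).homologyClass = Submodule.Quotient.mk
        ((1 : ℝ) • (⟨(H.circle i).chain, (H.circle i).chain_mem_cycles⟩ : M.cycles) +
          (-(((η * ε : ℤˣ) : ℤ) : ℝ)) •
            (⟨(H.circle k).chain, (H.circle k).chain_mem_cycles⟩ : M.cycles)) := rfl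
  rw [hcls, OrientedCircle.homologyClass, mk_eq_mk_iff]
  convert hb' using 1
  rw [hP.boundary]
  ext d
  simp only [Submodule.coe_add, Submodule.coe_smul, Pi.sub_apply, Pi.add_apply, Pi.smul_apply,
    smul_eq_mul, Units.val_mul, Units.val_neg, Int.cast_mul, Int.cast_neg]
  linear_combination ((H.circle i).chain d - (H'.circle i).chain d) * hη

/-- The Lagrangian subspace is determined by the classes of the circles. -/
theorem map_lagrangian {Dart' : Type*} [Fintype Dart'] [DecidableEq Dart'] {M' : CellSurface Dart'}
    (Φ : M.H1 ≃ₗ[ℝ] M'.H1) (H : M.HandlebodyDiagram ι) (H' : M'.HandlebodyDiagram ι)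
    (h : ∀ i, Φ (H.circle i).homologyClass = (H'.circle i).homologyClass) :
    H.lagrangian.map Φ.toLinearMap = H'.lagrangian := by
  rw [H.lagrangian_eq_span, H'.lagrangian_eq_span, Submodule.map_span, ← Set.range_comp]
  congr 2
  exact funext h

end HandlebodyDiagram

namespace HeegaardDiagram

section CircleVector

variable (D : M.HeegaardDiagram ι κ)

theorem circleVector_inl_fst (i : ι) :
    ((D.circleVector (Sum.inl i)).1 : M.H1) = (D.lower.circle i).homologyClass := rfl

theorem circleVector_inl_snd (i : ι) : ((D.circleVector (Sum.inl i)).2 : M.H1) = 0 := rfl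

theorem circleVector_inr_fst (j : κ) : ((D.circleVector (Sum.inr j)).1 : M.H1) = 0 := rfl

theorem circleVector_inr_snd (j : κ) :
    ((D.circleVector (Sum.inr j)).2 : M.H1) = (D.upper.circle j).homologyClass := rfl

end CircleVector

variable [DecidableEq ι] [DecidableEq κ] {D D' : M.HeegaardDiagram ι κ}

/-- The effect of an elementary operation on the classes of the lower or of the upper circles. -/
theorem IsCassonOrientation.exists_of_homologyClass_eq {x k : ι ⊕ κ} {s t : ℝ}
    (hk : x ≠ k ∨ t = 0)
    (hl : D'.lower.lagrangian = D.lower.lagrangian)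
    (hu : D'.upper.lagrangian = D.upper.lagrangian)
    (hw : ∀ y, ((D'.circleVector y).1 : M.H1) =
        (Function.update D.circleVector x (s • D.circleVector x + t • D.circleVector k) y).1 ∧
      ((D'.circleVector y).2 : M.H1) =
        (Function.update D.circleVector x (s • D.circleVector x + t • D.circleVector k) y).2)
    {o : VOrientation D.directSum} (ho : D.IsCassonOrientation o) :
    ∃ o' : VOrientation D'.directSum, D'.IsCassonOrientation o' ∧
      ∀ e : CompleteOrdering (ι ⊕ κ),
        orientationSign o' (fun n => D'.circleVector (Equiv.toFun e n)) =
          SignType.sign s * orientationSign o (fun n => D.circleVector (Equiv.toFun e n)) := by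
  obtain ⟨Ψ, o', hΨ, ho', h⟩ := ho.exists_comp (D' := D') (LinearEquiv.refl ℝ M.H1)
    (fun _ _ => rfl) (by rw [hl]; exact Submodule.map_id _) (by rw [hu]; exact Submodule.map_id _)
  refine ⟨o', ho', fun e => ?_⟩
  rw [← orientationSign_update o D.circleVector e hk, ← h]
  congr 1
  ext1 n
  refine Prod.ext (Subtype.ext ?_) (Subtype.ext ?_)
  · rw [(hΨ _).1, (hw _).1]; rfl
  · rw [(hΨ _).2, (hw _).2]; rfl

theorem IsCassonOrientation.exists_of_lower {i k : ι} {s t : ℝ} (hs : s ≠ 0) (hk : i ≠ k ∨ t = 0)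
    (hi : (D'.lower.circle i).homologyClass =
      s • (D.lower.circle i).homologyClass + t • (D.lower.circle k).homologyClass)
    (hj : ∀ j, j ≠ i → (D'.lower.circle j).homologyClass = (D.lower.circle j).homologyClass)
    (hu : D'.upper = D.upper) {o : VOrientation D.directSum} (ho : D.IsCassonOrientation o) :
    ∃ o' : VOrientation D'.directSum, D'.IsCassonOrientation o' ∧
      ∀ e : CompleteOrdering (ι ⊕ κ),
        orientationSign o' (fun n => D'.circleVector (Equiv.toFun e n)) =
          SignType.sign s * orientationSign o (fun n => D.circleVector (Equiv.toFun e n)) := by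
  refine ho.exists_of_homologyClass_eq (x := Sum.inl i) (k := Sum.inl k) (t := t)
    (hk.imp_left Sum.inl_injective.ne)
    (HandlebodyDiagram.lagrangian_eq_of_homologyClass_eq hs hk hi hj) (by rw [hu]) ?_
  rintro (j | j)
  · by_cases h : j = i
    · rw [h, Function.update_self, Prod.fst_add, Prod.snd_add, Prod.smul_fst, Prod.smul_snd,
        Prod.smul_fst, Prod.smul_snd]
      simp only [Submodule.coe_add, Submodule.coe_smul, circleVector_inl_fst, circleVector_inl_snd,
        hi, smul_zero, add_zero, and_self]
    · rw [Function.update_of_ne (Sum.inl_injective.ne h)]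
      simp only [circleVector_inl_fst, circleVector_inl_snd, hj j h, and_self]
  · rw [Function.update_of_ne Sum.inr_ne_inl]
    simp only [circleVector_inr_fst, circleVector_inr_snd, hu, and_self]

theorem IsCassonOrientation.exists_of_upper {i k : κ} {s t : ℝ} (hs : s ≠ 0) (hk : i ≠ k ∨ t = 0)
    (hi : (D'.upper.circle i).homologyClass =
      s • (D.upper.circle i).homologyClass + t • (D.upper.circle k).homologyClass)
    (hj : ∀ j, j ≠ i → (D'.upper.circle j).homologyClass = (D.upper.circle j).homologyClass)
    (hl : D'.lower = D.lower) {o : VOrientation D.directSum} (ho : D.IsCassonOrientation o) :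
    ∃ o' : VOrientation D'.directSum, D'.IsCassonOrientation o' ∧
      ∀ e : CompleteOrdering (ι ⊕ κ),
        orientationSign o' (fun n => D'.circleVector (Equiv.toFun e n)) =
          SignType.sign s * orientationSign o (fun n => D.circleVector (Equiv.toFun e n)) := by
  refine ho.exists_of_homologyClass_eq (x := Sum.inr i) (k := Sum.inr k) (t := t)
    (hk.imp_left Sum.inr_injective.ne) (by rw [hl])
    (HandlebodyDiagram.lagrangian_eq_of_homologyClass_eq hs hk hi hj) ?_
  rintro (j | j)
  · rw [Function.update_of_ne Sum.inl_ne_inr]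
    simp only [circleVector_inl_fst, circleVector_inl_snd, hl, and_self]
  · by_cases h : j = i
    · rw [h, Function.update_self, Prod.fst_add, Prod.snd_add, Prod.smul_fst, Prod.smul_snd,
        Prod.smul_fst, Prod.smul_snd]
      simp only [Submodule.coe_add, Submodule.coe_smul, circleVector_inr_fst, circleVector_inr_snd,
        hi, smul_zero, add_zero, and_self]
    · rw [Function.update_of_ne (Sum.inr_injective.ne h)]
      simp only [circleVector_inr_fst, circleVector_inr_snd, hj j h, and_self]

theorem IsCanonicalSignOrdering.of_isCircleSlide (h : D.IsCircleSlide D')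
    {s : SignOrdering (ι ⊕ κ)} (hs : D.IsCanonicalSignOrdering s) :
    D'.IsCanonicalSignOrdering s := by
  obtain ⟨o, ho, hs⟩ := hs
  have key : ∃ o' : VOrientation D'.directSum, D'.IsCassonOrientation o' ∧
      ∀ e : CompleteOrdering (ι ⊕ κ),
        orientationSign o' (fun n => D'.circleVector (Equiv.toFun e n)) =
          SignType.sign (1 : ℝ) *
            orientationSign o (fun n => D.circleVector (Equiv.toFun e n)) := by
    rcases h with ⟨h, hu⟩ | ⟨hl, h⟩
    · obtain ⟨i, k, t, hik, hi, hj⟩ := h.homologyClass_eq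
      exact ho.exists_of_lower one_ne_zero (Or.inl hik) hi hj hu
    · obtain ⟨i, k, t, hik, hi, hj⟩ := h.homologyClass_eq
      exact ho.exists_of_upper one_ne_zero (Or.inl hik) hi hj hl
  obtain ⟨o', ho', h'⟩ := key
  refine ⟨o', ho', fun e => ?_⟩
  rw [hs e, h', sign_one, one_mul]

theorem IsReversal.isReverse (hD : D.IsMinimal) (h : D.IsReversal D')
    {s s' : SignOrdering (ι ⊕ κ)} (hs : D.IsCanonicalSignOrdering s)
    (hs' : D'.IsCanonicalSignOrdering s') : s.IsReverse s' := by
  obtain ⟨o, ho, hs⟩ := hs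
  obtain ⟨o', ho', hs'⟩ := hs'
  -- The orientation of `D'` is transported to `D`, where uniqueness is known.
  have key : Nonempty (ι ⊕ κ) ∧ ∃ o₁ : VOrientation D.directSum, D.IsCassonOrientation o₁ ∧
      ∀ e : CompleteOrdering (ι ⊕ κ),
        orientationSign o₁ (fun n => D.circleVector (Equiv.toFun e n)) =
          SignType.sign (-1 : ℝ) *
            orientationSign o' (fun n => D'.circleVector (Equiv.toFun e n)) := by
    have h1 : (-1 : ℝ) ≠ 0 := neg_ne_zero.mpr one_ne_zero
    rcases h with ⟨h, hu⟩ | ⟨hl, h⟩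
    · obtain ⟨i, hi, hj⟩ := h.homologyClass_eq
      exact ⟨⟨Sum.inl i⟩, ho'.exists_of_lower h1 (Or.inr rfl) hi hj hu.symm⟩
    · obtain ⟨i, hi, hj⟩ := h.homologyClass_eq
      exact ⟨⟨Sum.inr i⟩, ho'.exists_of_upper h1 (Or.inr rfl) hi hj hl.symm⟩
  obtain ⟨hne, o₁, ho₁, h'⟩ := key
  obtain rfl := hD.existsUnique_isCassonOrientation.unique ho₁ ho
  obtain ⟨e, rfl⟩ := Quotient.mk_surjective s
  obtain ⟨π, hπ⟩ := hD.exists_sign_eq_neg_one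
  have he := (hs e).mp rfl
  refine ⟨e, π, hπ, rfl, (hs' _).mpr ?_⟩
  rw [orientationSign_smul, hπ, ← he, h']
  congr 1
  simp

theorem IsCanonicalSignOrdering.of_linearEquiv {Dart' : Type*} [Fintype Dart'] [DecidableEq Dart']
    {M' : CellSurface Dart'} {D' : M'.HeegaardDiagram ι κ} (Φ : M.H1 ≃ₗ[ℝ] M'.H1)
    (hΦ : ∀ x y, M'.intersectionForm (Φ x) (Φ y) = M.intersectionForm x y)
    (hl : ∀ i, Φ (D.lower.circle i).homologyClass = (D'.lower.circle i).homologyClass)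
    (hu : ∀ j, Φ (D.upper.circle j).homologyClass = (D'.upper.circle j).homologyClass)
    {s : SignOrdering (ι ⊕ κ)} (hs : D.IsCanonicalSignOrdering s) :
    D'.IsCanonicalSignOrdering s := by
  obtain ⟨o, ho, hs⟩ := hs
  obtain ⟨Ψ, o', hΨ, ho', h⟩ := ho.exists_comp (D' := D') Φ hΦ
    (HandlebodyDiagram.map_lagrangian Φ _ _ hl) (HandlebodyDiagram.map_lagrangian Φ _ _ hu)
  refine ⟨o', ho', fun e => ?_⟩
  rw [hs e, ← h]
  have : (fun n => Ψ (D.circleVector (Equiv.toFun e n))) =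
      fun n => D'.circleVector (Equiv.toFun e n) := by
    ext1 n
    generalize Equiv.toFun e n = x
    refine Prod.ext (Subtype.ext ?_) (Subtype.ext ?_)
    · rw [(hΨ _).1]
      rcases x with i | j
      exacts [hl i, map_zero Φ]
    · rw [(hΨ _).2]
      rcases x with i | j
      exacts [map_zero Φ, hu j]
  rw [this]

end HeegaardDiagram

end CellSurface

theorem mainTheorem8 {Dart ι κ : Type*} [Fintype Dart] [DecidableEq Dart] [Fintype ι] [DecidableEq ι]
    [Fintype κ] [DecidableEq κ] (M : CellSurface Dart) (D : M.HeegaardDiagram ι κ)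
    (hD : D.IsMinimal) :
    -- the intersection form is symplectic
    (M.intersectionForm.IsAlt ∧ M.intersectionForm.Nondegenerate) ∧
    -- the circles form a basis of `L_l ⊕ L_u`
    (LinearIndependent ℝ D.circleVector ∧ Submodule.span ℝ (Set.range D.circleVector) = ⊤) ∧
    -- the sequence `0 → L_l ∩ L_u → L_l ⊕ L_u → H₁(R, ℝ) → (L_l ∩ L_u)^* → 0` is exact
    (Function.Injective D.interToSum ∧ Function.Exact D.interToSum D.sumToH1 ∧
      Function.Exact D.sumToH1 D.h1ToDual ∧ Function.Surjective D.h1ToDual) ∧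
    -- it induces a well-defined orientation and a well-defined sign-ordering
    (∃! o : VOrientation D.directSum, D.IsCassonOrientation o) ∧
    (∃! s : SignOrdering (ι ⊕ κ), D.IsCanonicalSignOrdering s) ∧
    -- the sign-ordering is preserved by circle slides
    (∀ D' : M.HeegaardDiagram ι κ, D.IsCircleSlide D' → ∀ s : SignOrdering (ι ⊕ κ),
      D.IsCanonicalSignOrdering s → D'.IsCanonicalSignOrdering s) ∧
    -- the sign-ordering is reversed if the orientation of one circle is reversed
    (∀ D' : M.HeegaardDiagram ι κ, D.IsReversal D' → ∀ s s' : SignOrdering (ι ⊕ κ),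
      D.IsCanonicalSignOrdering s → D'.IsCanonicalSignOrdering s' → s.IsReverse s') ∧
    -- it depends only on `H₁(R, ℝ)`, the intersection form and the classes of the circles
    (∀ {Dart' : Type*} [Fintype Dart'] [DecidableEq Dart'] (M' : CellSurface Dart')
      (D' : M'.HeegaardDiagram ι κ) (Φ : M.H1 ≃ₗ[ℝ] M'.H1),
      (∀ x y, M'.intersectionForm (Φ x) (Φ y) = M.intersectionForm x y) →
      (∀ i, Φ (D.lower.circle i).homologyClass = (D'.lower.circle i).homologyClass) →
      (∀ j, Φ (D.upper.circle j).homologyClass = (D'.upper.circle j).homologyClass) →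
      ∀ s : SignOrdering (ι ⊕ κ),
        D.IsCanonicalSignOrdering s → D'.IsCanonicalSignOrdering s) := by
  obtain ⟨b, hb⟩ := hD.exists_basis
  exact ⟨⟨M.intersectionForm_isAlt, M.intersectionForm_nondegenerate⟩,
    ⟨hb ▸ b.linearIndependent, hb ▸ b.span_eq⟩,
    ⟨D.interToSum_injective, D.exact_interToSum_sumToH1, hD.exact_sumToH1_h1ToDual,
      D.h1ToDual_surjective⟩,
    hD.existsUnique_isCassonOrientation, hD.existsUnique_isCanonicalSignOrdering,
    fun _ h _ hs => hs.of_isCircleSlide h,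
    fun _ h _ _ hs hs' => h.isReverse hD hs hs',
    fun _ _ Φ hΦ hl hu _ hs => hs.of_linearEquiv Φ hΦ hl hu⟩
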